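/- Let $G$ be a connected (finite or infinite) simple graph with shortest-path distance $d$. Conventions: $I(x,y)=\{z: d(x,y)=d(x,z)+d(z,y)\}$ is the interval between $x$ and $y$. A connected graph is median if $I(x,y)\cap I(y,z)\cap I(z,x)$ is a singleton, the median of $x,y,z$, for all vertices $x,y,z$. A graph is an isometric subgraph of another one if it is isomorphic to a subgraph of it in which all distances agree with those of the larger graph; a median subgraph is an isometric subgraph that contains with any three of its vertices their (unique) median in the larger graph. A hypercube is a weak Cartesian power of $K_2$ (its vertices are the finite subsets of a set $X$, two being adjacent if they differ in exactly one element). A set $A$ of vertices is convex if $I(x,y)\subseteq A$ for all $x,y\in A$, and a convex split is a partition $\{A,B\}$ of the vertex set into two nonempty convex sets. $\mathrm{Inc}(G)$ is the graph whose vertices are the convex splits of $G$, with $\{A_1,B_1\}$ and $\{A_2,B_2\}$ adjacent iff $A_1\cap A_2$, $A_1\cap B_2$, $B_1\cap A_2$, $B_1\cap B_2$ are all nonempty. $|G|$ is the cube complex obtained from $G$ by filling in all its cubes; so its 1-cells are the edges and its 2-cells the induced 4-cycles of $G$. $\mathrm{Link}(x)$ is the graph whose vertices are the edges of $G$ at the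 vertex $x$, two of them being adjacent iff they lie in a common 2-cell. $\mathrm{Link}(|G|)$ is the union of the graphs $\mathrm{Link}(x)$ over all vertices $x$, a graph whose vertices are the edges of $G$. The simplex graph $\kappa(F)$ of a graph $F$ has the cliques of $F$ (including $\emptyset$) as vertices, two being adjacent iff they differ by the presence of exactly one vertex of $F$. $C_n$ is the $n$-cycle, and $Q_3-v$ is the 3-cube minus a vertex. The following conditions are equivalent: (i) $G$ is an isometric subgraph of the Cartesian product of two trees; (ii) $G$ is a median subgraph of the Cartesian product of two trees; (iii) $G$ is a median graph and $\mathrm{Inc}(G)$ is bipartite; (iv) $G$ is a median graph and $\mathrm{Link}(|G|)$ is bipartite; (v) $G$ is a median graph and $\mathrm{Link}(x)$ is bipartite for every vertex $x$ of $G$; (vi) $G$ is a median graph that contains neither $Q_3-v$ nor any $\kappa(C_{2k+1})$, $k\ge 2$, as an isometric subgraph; (vii) $G$ is an isometric subgraph of a hypercube, and for every $k\ge 2$ neither $C_{2k+2}$ nor $\kappa(C_{2k+1})$ is an isometric subgraph of $G$; (viii) neither $C_3$ nor $K_{2,3}$ is an isometric subgraph of $G$, and for every $k\ge 2$ neither $C_{k+3}$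 nor $\kappa(C_{2k+1})$ is an isometric subgraph of $G$. -/

import Mathlib

open SimpleGraph

universe u v

namespace DoubleTree

section Metric

variable {V : Type u} {W : Type v}

/-- `f` is an isometric embedding of the graph `G` into the graph `H`: it preserves the shortest-path
distance. (`edist` is the distance with value `⊤` between different connected components; an
isometric embedding is automatically injective and induces an isomorphism onto an induced
subgraph.) -/
def IsIsometric (G : SimpleGraph V) (H : SimpleGraph W) (f : V → W) : Prop :=
  ∀ x y : V, H.edist (f x) (f y) = G.edist x y

/-- `G` is (isomorphic to) an isometric subgraph of `H`. -/
def IsIsometricSubgraph (G : SimpleGraph V) (H : SimpleGraph W) : Prop :=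
  ∃ f : V → W, IsIsometric G H f

/-- The interval `I(x, y)` of a connected graph. -/
def interval (G : SimpleGraph V) (x y : V) : Set V :=
  {z | G.dist x y = G.dist x z + G.dist z y}

/-- The median set `m(x, y, z) = I(x, y) ∩ I(y, z) ∩ I(z, x)`. -/
def medianSet (G : SimpleGraph V) (x y z : V) : Set V :=
  interval G x y ∩ interval G y z ∩ interval G z x

/-- A median graph: a connected graph in which every median set is a singleton. -/
def IsMedian (G : SimpleGraph V) : Prop :=
  G.Connected ∧ ∀ x y z : V, ∃ m : V, medianSet G x y z = {m}

/-- `G` is (isomorphic to) a median subgraph of `H`: an isometric subgraph that contains, with any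
three of its vertices, their unique median in `H`. -/
def IsMedianSubgraph (G : SimpleGraph V) (H : SimpleGraph W) : Prop :=
  ∃ f : V → W, IsIsometric G H f ∧
    ∀ x y z : V, ∃ m : V, medianSet H (f x) (f y) (f z) = {f m}

/-- A partial double tree: an isometric subgraph of the Cartesian product of two trees. -/
def IsPartialDoubleTree (G : SimpleGraph V) : Prop :=
  ∃ (V₁ V₂ : Type u) (T₁ : SimpleGraph V₁) (T₂ : SimpleGraph V₂),
    T₁.IsTree ∧ T₂.IsTree ∧ IsIsometricSubgraph G (T₁ □ T₂)

/-- `G` is a median subgraph of the Cartesian product of two trees. -/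
def IsMedianSubgraphOfTwoTrees (G : SimpleGraph V) : Prop :=
  ∃ (V₁ V₂ : Type u) (T₁ : SimpleGraph V₁) (T₂ : SimpleGraph V₂),
    T₁.IsTree ∧ T₂.IsTree ∧ IsMedianSubgraph G (T₁ □ T₂)

end Metric

section Splits

variable {V : Type u}

/-- A set of vertices is (interval-)convex. -/
def IsConvex (G : SimpleGraph V) (A : Set V) : Prop :=
  ∀ x ∈ A, ∀ y ∈ A, interval G x y ⊆ A

/-- A convex split `{A, V ∖ A}`: a partition of the vertex set into two nonempty convex sets. -/
def IsConvexSplit (G : SimpleGraph V) (σ : Set (Set V)) : Prop :=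
  ∃ A : Set V, σ = {A, Aᶜ} ∧ A.Nonempty ∧ Aᶜ.Nonempty ∧ IsConvex G A ∧ IsConvex G Aᶜ

/-- The incompatibility graph `Inc(G)`: its vertices are the convex splits of `G`, and two splits
are adjacent if every part of the one meets every part of the other. -/
def incGraph (G : SimpleGraph V) : SimpleGraph {σ : Set (Set V) // IsConvexSplit G σ} where
  Adj σ τ := ∀ A ∈ σ.1, ∀ B ∈ τ.1, (A ∩ B).Nonempty
  symm := ⟨fun σ τ h B hB A hA => by rw [Set.inter_comm]; exact h A hA B hB⟩
  loopless := ⟨by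
    rintro ⟨σ, A, hσ, _⟩ h
    subst hσ
    have h' := h A (by simp) Aᶜ (by simp)
    simp at h'⟩

end Splits

section Links

variable {V : Type u}

/-- `x, y, z, w` are, in this cyclic order, the vertices of an induced 4-cycle of `G`, that is, of
a 2-cell of the cube complex `|G|`. -/
def IsInducedC4 (G : SimpleGraph V) (x y z w : V) : Prop :=
  G.Adj x y ∧ G.Adj y z ∧ G.Adj z w ∧ G.Adj w x ∧
    x ≠ z ∧ y ≠ w ∧ ¬ G.Adj x z ∧ ¬ G.Adj y w

theorem IsInducedC4.reflect {G : SimpleGraph V} {x y z w : V} (h : IsInducedC4 G x y z w) :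
    IsInducedC4 G x w z y := by
  obtain ⟨h1, h2, h3, h4, h5, h6, h7, h8⟩ := h
  exact ⟨h4.symm, h3.symm, h2.symm, h1.symm, h5, h6.symm, h7, fun h => h8 h.symm⟩

/-- The graph `Link(x)` of a vertex `x` of `|G|`: its vertices are the 1-cells (edges of `G`)
containing `x`, and two of them are adjacent if they are the two sides at `x` of a common 2-cell
(induced 4-cycle). -/
def vertexLink (G : SimpleGraph V) (x : V) : SimpleGraph {e : Sym2 V // e ∈ G.incidenceSet x} where
  Adj e f := ∃ y z w : V, IsInducedC4 G x y z w ∧ e.1 = s(x, y) ∧ f.1 = s(x, w)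
  symm := ⟨by
    rintro e f ⟨y, z, w, h, he, hf⟩
    exact ⟨w, z, y, h.reflect, hf, he⟩⟩
  loopless := ⟨by
    rintro e ⟨y, z, w, h, he, hf⟩
    rw [he, Sym2.congr_right] at hf
    exact h.2.2.2.2.2.1 hf⟩

/-- The link graph `Link(|G|)`: the union of the graphs `Link(x)` over all vertices `x`. Its
vertices are the edges of `G`; the two ends of an edge do not give separate copies of it. -/
def linkGraph (G : SimpleGraph V) : SimpleGraph {e : Sym2 V // e ∈ G.edgeSet} where
  Adj e f := ∃ (x : V) (he : e.1 ∈ G.incidenceSet x) (hf : f.1 ∈ G.incidenceSet x),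
    (vertexLink G x).Adj ⟨e.1, he⟩ ⟨f.1, hf⟩
  symm := ⟨by
    rintro e f ⟨x, he, hf, h⟩
    exact ⟨x, hf, he, h.symm⟩⟩
  loopless := ⟨by
    rintro e ⟨x, he, hf, h⟩
    exact h.ne rfl⟩

end Links

section Examples

/-- The hypercube on a (possibly infinite) set `X` of coordinates, i.e. the weak Cartesian power of
`K₂`: its vertices are the finite subsets of `X`, and two of them are adjacent if one is obtained
from the other by adding exactly one element (`⋖` is the covering relation of inclusion). -/
def hypercube (X : Type u) : SimpleGraph (Finset X) where
  Adj s t := s ⋖ t ∨ t ⋖ s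
  symm := ⟨fun _ _ h => h.symm⟩
  loopless := ⟨fun s h => by simp at h⟩

/-- The simplex graph `κ(F)`: its vertices are the (finite) cliques of `F`, including the empty one,
and two cliques are adjacent if they differ by the presence of exactly one vertex. -/
def simplexGraph {X : Type u} (F : SimpleGraph X) : SimpleGraph {s : Finset X // F.IsClique s} where
  Adj s t := (hypercube X).Adj s.1 t.1
  symm := ⟨fun _ _ h => h.symm⟩
  loopless := ⟨fun _ h => h.ne rfl⟩

/-- The cube `Q₃` minus one vertex. -/
def cubeMinusVertex : SimpleGraph {s : Finset (Fin 3) // s ≠ Finset.univ} where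
  Adj s t := (hypercube (Fin 3)).Adj s.1 t.1
  symm := ⟨fun _ _ h => h.symm⟩
  loopless := ⟨fun _ h => h.ne rfl⟩

/-- The cogwheel `κ(Cₙ)`. -/
def cogwheel (n : ℕ) : SimpleGraph {s : Finset (Fin n) // (cycleGraph n).IsClique s} :=
  simplexGraph (cycleGraph n)

/-- The complete bipartite graph `K_{2,3}`. -/
def K23 : SimpleGraph (Fin 2 ⊕ Fin 3) := completeBipartiteGraph (Fin 2) (Fin 3)

end Examples

end DoubleTree

/-! Everything rests on halfspaces, the convex sets with convex complement. A median graph is used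
through `IsLocallyMedian`: connected, bipartite, with the quadrangle condition and without
`K_{2,3}`. Then opposite sides of a square are cut by the same halfspace, and any two edges cut by
one halfspace are joined by a ladder of squares (`exists_ladder`). So convex splits are parallelism
classes of edges, the halfspaces containing a vertex are its coordinates in a hypercube, and
crossing splits already cross in a square.

Bipartiteness therefore passes between local and global. A 2-colouring of `Link(|G|)` is constant
along ladders, hence colours `Inc(G)`. Colourings of the single links can be glued, because their
disagreement along edges sums to zero mod 2 on every square and is thus a coboundary
(`exists_potential`). A link that is not bipartite has an isometric odd cycle, and its cube
coordinates exhibit `Q₃ - v` or a cogwheel. Given a 2-colouring of `Inc(G)`, halfspaces of one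
colour never cross, so they define a tree as quotient; the two quotients together keep all
distances.

An isometric subgraph of a product of two trees is closed under medians (`exists_eq_median`): three
vertices none of which can step towards their median would give three pairwise incomparable subsets
of the two coordinates. In the other direction, forbidden cycles force medians: a shortest odd
closed walk is an isometric cycle, and a failure of the quadrangle condition at the lowest level
yields an isometric even cycle of length at least 6. -/

namespace DoubleTree

open scoped symmDiff

/-! ### Distances and isometric embeddings. -/

section Distance

variable {V : Type u} {W : Type v} {G : SimpleGraph V} {H : SimpleGraph W}

theorem dist_le_succ_of_adj (hG : G.Connected) {x y : V} (h : G.Adj x y) (z : V) :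
    G.dist z x ≤ G.dist z y + 1 := by
  have h1 := hG.dist_triangle (u := z) (v := y) (w := x)
  have h2 : G.dist y x = 1 := dist_eq_one_iff_adj.2 h.symm
  omega

theorem exists_adj_dist_eq_succ (hG : G.Connected) {x y : V} (hxy : x ≠ y) :
    ∃ x', G.Adj x x' ∧ G.dist x y = G.dist x' y + 1 := by
  obtain ⟨p, hp⟩ := hG.exists_walk_length_eq_dist x y
  cases p with
  | nil => exact (hxy rfl).elim
  | cons h q =>
    rename_i x'
    refine ⟨x', h, ?_⟩
    have h1 := dist_le q
    have h2 := dist_le_succ_of_adj hG h y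
    rw [G.dist_comm (u := y), G.dist_comm (u := y)] at h2
    simp only [Walk.length_cons] at hp
    omega

theorem edist_map_le (f : V → W) (hf : ∀ x y, G.Adj x y → H.Adj (f x) (f y)) (x y : V) :
    H.edist (f x) (f y) ≤ G.edist x y := by
  by_cases h : G.edist x y = ⊤
  · simp [h]
  · obtain ⟨p, hp⟩ := exists_walk_of_edist_ne_top h
    rw [← hp]
    have := edist_le (p.map (⟨f, fun {a b} => hf a b⟩ : G →g H))
    simpa using this

theorem IsIsometric.adj {f : V → W} (hf : IsIsometric G H f) {x y : V} :
    H.Adj (f x) (f y) ↔ G.Adj x y := by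
  rw [← edist_eq_one_iff_adj, ← edist_eq_one_iff_adj, hf]

theorem IsIsometric.injective {f : V → W} (hf : IsIsometric G H f) : Function.Injective f := by
  intro x y h
  rw [← edist_eq_zero_iff (G := G), ← hf, h, edist_self]

theorem IsIsometric.dist {f : V → W} (hf : IsIsometric G H f) (x y : V) :
    H.dist (f x) (f y) = G.dist x y := by
  rw [SimpleGraph.dist, SimpleGraph.dist, hf]

theorem IsIsometricSubgraph.trans {U : Type*} {K : SimpleGraph U}
    (h : IsIsometricSubgraph G H) (h' : IsIsometricSubgraph H K) : IsIsometricSubgraph G K := by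
  obtain ⟨f, hf⟩ := h
  obtain ⟨g, hg⟩ := h'
  exact ⟨g ∘ f, fun x y => (hg _ _).trans (hf _ _)⟩

theorem exists_walk_of_steps {f : ℕ → V} {L : ℕ} (hf : ∀ k < L, G.Adj (f k) (f (k + 1)))
    {i j : ℕ} (hij : i ≤ j) (hj : j ≤ L) : ∃ p : G.Walk (f i) (f j), p.length = j - i := by
  induction j, hij using Nat.le_induction with
  | base => exact ⟨Walk.nil, by simp⟩
  | succ j hij ih =>
    obtain ⟨p, hp⟩ := ih (by omega)
    exact ⟨p.concat (hf j (by omega)), by rw [Walk.length_concat, hp]; omega⟩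

end Distance

/-! ### Isometric cycles and odd closed walks. -/

section Cycles

variable {V : Type u} {G : SimpleGraph V}

theorem cycleGraph_adj_iff_val {n : ℕ} (hn : 2 ≤ n) (i j : Fin n) :
    (cycleGraph n).Adj i j ↔ i.val + 1 = j.val ∨ j.val + 1 = i.val ∨
      (i.val = 0 ∧ j.val + 1 = n) ∨ (j.val = 0 ∧ i.val + 1 = n) := by
  rw [cycleGraph_adj', Fin.val_sub, Fin.val_sub]
  have hi := i.isLt
  have hj := j.isLt
  rcases lt_trichotomy i.val j.val with h | h | h
  · rw [Nat.mod_eq_of_lt (a := n - j.val + i.val) (by omega),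
      Nat.mod_eq_sub_mod (a := n - i.val + j.val) (by omega),
      Nat.mod_eq_of_lt (a := n - i.val + j.val - n) (by omega)]
    omega
  · rw [h, Nat.sub_add_cancel hj.le, Nat.mod_self]
    omega
  · rw [Nat.mod_eq_of_lt (a := n - i.val + j.val) (by omega),
      Nat.mod_eq_sub_mod (a := n - j.val + i.val) (by omega),
      Nat.mod_eq_of_lt (a := n - j.val + i.val - n) (by omega)]
    omega

theorem cycleGraph_edist_le_sub {n : ℕ} (hn : 2 ≤ n) {i j : Fin n} (hij : i.val ≤ j.val) :
    (cycleGraph n).edist i j ≤ (j.val - i.val : ℕ) := by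
  let f : ℕ → Fin n := fun k => if h : k < n then ⟨k, h⟩ else ⟨0, by omega⟩
  have hfv : ∀ k : Fin n, f k.val = k := fun k => by simp [f]
  have hf : ∀ k < n - 1, (cycleGraph n).Adj (f k) (f (k + 1)) := by
    intro k hk
    rw [cycleGraph_adj_iff_val hn]
    simp [f, show k < n by omega, show k + 1 < n by omega]
  obtain ⟨p, hp⟩ := exists_walk_of_steps hf hij (by omega)
  have := edist_le p
  rwa [hp, hfv, hfv] at this

theorem cycleGraph_edist_le_sub_sub {n : ℕ} (hn : 2 ≤ n) {i j : Fin n} (hij : i.val ≤ j.val) :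
    (cycleGraph n).edist i j ≤ (n - (j.val - i.val) : ℕ) := by
  have hj := j.isLt
  set a : Fin n := ⟨0, by omega⟩
  set b : Fin n := ⟨n - 1, by omega⟩
  have h1 := cycleGraph_edist_le_sub hn (i := a) (j := i) (by simp [a])
  have h2 := cycleGraph_edist_le_sub hn (i := j) (j := b) (by change j.val ≤ n - 1; omega)
  have h3 : (cycleGraph n).edist a b = 1 := by
    rw [edist_eq_one_iff_adj, cycleGraph_adj_iff_val hn]
    exact Or.inr (Or.inr (Or.inl ⟨rfl, by change n - 1 + 1 = n; omega⟩))
  rw [SimpleGraph.edist_comm] at h1 h2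
  calc (cycleGraph n).edist i j ≤ (cycleGraph n).edist i a + (cycleGraph n).edist a j :=
        SimpleGraph.edist_triangle
    _ ≤ (cycleGraph n).edist i a + ((cycleGraph n).edist a b + (cycleGraph n).edist b j) := by
        gcongr; exact SimpleGraph.edist_triangle
    _ ≤ (i.val - a.val : ℕ) + (1 + (b.val - j.val : ℕ)) := by
        rw [h3]; gcongr
    _ = (n - (j.val - i.val) : ℕ) := by
        norm_cast
        change i.val - 0 + (1 + (n - 1 - j.val)) = _
        omega

/-- A closed walk on which no two vertices are closer in `G` than along the walk is an isometric
cycle. -/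
theorem isIsometric_cycleGraph {L : ℕ} (hL : 3 ≤ L) {f : ℕ → V}
    (hf : ∀ k < L, G.Adj (f k) (f (k + 1))) (hclosed : f L = f 0)
    (hmin : ∀ i j, i < j → j < L →
      ((min (j - i) (L - (j - i)) : ℕ) : ℕ∞) ≤ G.edist (f i) (f j)) :
    IsIsometric (cycleGraph L) G (fun i : Fin L => f i) := by
  have hom : ∀ i j : Fin L, (cycleGraph L).Adj i j → G.Adj (f i) (f j) := by
    intro i j h
    rw [cycleGraph_adj_iff_val (by omega)] at h
    rcases h with h | h | ⟨h, h'⟩ | ⟨h, h'⟩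
    · rw [← h]; exact hf _ i.isLt
    · rw [← h]; exact (hf _ j.isLt).symm
    · have := hf j j.isLt
      rw [h', hclosed] at this
      rw [h]; exact this.symm
    · have := hf i i.isLt
      rw [h', hclosed] at this
      rw [h]; exact this
  have key : ∀ i j : Fin L, i.val < j.val → (cycleGraph L).edist i j ≤ G.edist (f i) (f j) := by
    intro i j hij
    refine le_trans ?_ (hmin i j hij j.isLt)
    rcases min_choice (j.val - i.val) (L - (j.val - i.val)) with h | h <;> rw [h]
    · exact cycleGraph_edist_le_sub (by omega) hij.le
    · exact cycleGraph_edist_le_sub_sub (by omega) hij.le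
  intro i j
  refine le_antisymm (edist_map_le (fun i : Fin L => f i) hom i j) ?_
  rcases lt_trichotomy i.val j.val with h | h | h
  · exact key i j h
  · rw [Fin.ext h, SimpleGraph.edist_self]; exact zero_le
  · rw [SimpleGraph.edist_comm, G.edist_comm]; exact key j i h

/-- A graph that is not bipartite contains an isometric odd cycle. -/
theorem exists_isometric_odd_cycle (h : ¬ G.IsBipartite) :
    ∃ k, 1 ≤ k ∧ IsIsometricSubgraph (cycleGraph (2 * k + 1)) G := by
  classical
  have hex : ∃ L, ∃ (u : V) (w : G.Walk u u), w.length = L ∧ Odd L := by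
    by_contra hno
    refine h (two_colorable_iff_forall_loop_even.2 fun u w => ?_)
    by_contra hw
    exact hno ⟨_, u, w, rfl, Nat.not_even_iff_odd.1 hw⟩
  obtain ⟨a, w, hwL, hodd⟩ := Nat.find_spec hex
  have hmin : ∀ (v : V) (p : G.Walk v v), Odd p.length → Nat.find hex ≤ p.length :=
    fun v p hp => Nat.find_min' hex ⟨v, p, rfl, hp⟩
  set L := Nat.find hex
  obtain ⟨k, hk⟩ := hodd
  have hf : ∀ i < L, G.Adj (w.getVert i) (w.getVert (i + 1)) :=
    fun i hi => w.adj_getVert_succ (by omega)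
  have hclosed : w.getVert L = w.getVert 0 := by
    rw [← hwL, Walk.getVert_length, Walk.getVert_zero]
  have hk1 : 1 ≤ k := by
    by_contra hk0
    have hL1 : L = 1 := by omega
    have := hf 0 (by omega)
    rw [show 0 + 1 = L by omega, hclosed] at this
    exact this.ne rfl
  refine ⟨k, hk1, ?_⟩
  rw [← hk]
  refine ⟨_, isIsometric_cycleGraph (by omega) hf hclosed fun i j hij hj => ?_⟩
  by_cases htop : G.edist (w.getVert i) (w.getVert j) = ⊤
  · rw [htop]; exact le_top
  obtain ⟨p, hp⟩ := exists_walk_of_edist_ne_top htop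
  rw [← hp, Nat.cast_le]
  obtain ⟨q, hq⟩ := exists_walk_of_steps hf hij.le hj.le
  obtain ⟨q₁, hq₁⟩ := exists_walk_of_steps hf (Nat.zero_le i) (by omega)
  obtain ⟨q₂, hq₂⟩ := exists_walk_of_steps hf hj.le le_rfl
  -- The chord `p` splits the closed walk into two closed walks whose lengths add up to `L + 2 *
  -- p.length`. One of them is odd, so by minimality it is no shorter than `L`.
  have h1 := hmin _ (q.append p.reverse)
  have h2 := hmin _ ((q₁.append p).append (q₂.copy rfl hclosed))
  simp only [Walk.length_append, Walk.length_reverse, Walk.length_copy, hq, hq₁, hq₂] at h1 h2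
  by_contra hlt
  rcases Nat.even_or_odd (j - i + p.length) with he | ho
  · have : Odd (i - 0 + p.length + (L - j)) := by
      rw [Nat.odd_iff]; rw [Nat.even_iff] at he; omega
    have := h2 this
    omega
  · have := h1 ho
    omega

end Cycles

/-! ### Distances in hypercubes and in their lower sets. -/

section Hypercube

variable {X : Type u}

theorem hypercube_adj_iff [DecidableEq X] {s t : Finset X} :
    (hypercube X).Adj s t ↔ (s ∆ t).card = 1 := by
  have key : ∀ s t : Finset X, s ⋖ t → (s ∆ t).card = 1 := by
    intro s t h
    obtain ⟨a, ha, rfl⟩ := Finset.covBy_iff_exists_insert.1 h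
    rw [Finset.card_eq_one]
    refine ⟨a, ?_⟩
    ext b
    simp only [Finset.mem_symmDiff, Finset.mem_insert, Finset.mem_singleton]
    grind
  constructor
  · rintro (h | h)
    · exact key _ _ h
    · rw [symmDiff_comm]; exact key _ _ h
  · intro h
    obtain ⟨a, ha⟩ := Finset.card_eq_one.1 h
    have hmem : ∀ b, (b ∈ s ∧ b ∉ t ∨ b ∈ t ∧ b ∉ s) ↔ b = a := by
      intro b
      rw [← Finset.mem_symmDiff, ha, Finset.mem_singleton]
    by_cases has : a ∈ s
    · right
      refine Finset.covBy_iff_exists_insert.2 ⟨a, ?_, ?_⟩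
      · have := (hmem a).2 rfl; tauto
      · ext b
        have := hmem b
        rw [Finset.mem_insert]
        by_cases hb : b = a
        · subst hb; tauto
        · tauto
    · left
      refine Finset.covBy_iff_exists_insert.2 ⟨a, has, ?_⟩
      ext b
      have := hmem b
      have := hmem a
      rw [Finset.mem_insert]
      by_cases hb : b = a
      · subst hb; tauto
      · tauto

theorem card_symmDiff_le_edist [DecidableEq X] (s t : Finset X) :
    ((s ∆ t).card : ℕ∞) ≤ (hypercube X).edist s t := by
  by_cases h : (hypercube X).edist s t = ⊤
  · rw [h]; exact le_top
  obtain ⟨p, hp⟩ := exists_walk_of_edist_ne_top h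
  rw [← hp, Nat.cast_le]
  clear hp h
  induction p with
  | nil => simp
  | @cons a b c hab q ih =>
    rw [Walk.length_cons]
    have h1 : (a ∆ c).card ≤ (a ∆ b).card + (b ∆ c).card :=
      (Finset.card_le_card (symmDiff_triangle a b c)).trans (Finset.card_union_le _ _)
    rw [hypercube_adj_iff.1 hab] at h1
    omega

/-- A subgraph of a hypercube induced on a lower set of finite sets is isometric. -/
theorem edist_eq_card_symmDiff_of_isLowerSet [DecidableEq X] {P : Finset X → Prop}
    (hP : ∀ s t, s ⊆ t → P t → P s) {K : SimpleGraph {s // P s}}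
    (hK : ∀ s t : {s // P s}, K.Adj s t ↔ (hypercube X).Adj s.1 t.1) (s t : {s // P s}) :
    K.edist s t = (s.1 ∆ t.1).card := by
  refine le_antisymm ?_ ((card_symmDiff_le_edist _ _).trans
    (edist_map_le Subtype.val (fun a b h => (hK a b).1 h) s t))
  -- Only deletions are sure to stay in a lower set, so whichever end has the surplus element is the
  -- one that moves.
  have erase : ∀ s t : {s // P s}, ∀ a ∈ s.1, a ∉ t.1 → ∃ s' : {s // P s}, K.Adj s s' ∧
      (s'.1 ∆ t.1).card + 1 = (s.1 ∆ t.1).card := by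
    intro s t a has hat
    refine ⟨⟨s.1.erase a, hP _ _ (Finset.erase_subset _ _) s.2⟩, ?_, ?_⟩
    · rw [hK]
      right
      exact Finset.covBy_iff_exists_insert.2 ⟨a, by simp, Finset.insert_erase has⟩
    · have : s.1.erase a ∆ t.1 = (s.1 ∆ t.1).erase a := by
        ext b
        simp only [Finset.mem_symmDiff, Finset.mem_erase]
        by_cases hb : b = a
        · subst hb; tauto
        · tauto
      rw [this, Finset.card_erase_add_one]
      rw [Finset.mem_symmDiff]; tauto
  induction hn : (s.1 ∆ t.1).card generalizing s t with
  | zero =>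
    rw [Finset.card_eq_zero, ← Finset.bot_eq_empty, symmDiff_eq_bot] at hn
    rw [Subtype.ext hn, edist_self]; simp
  | succ n ih =>
    obtain ⟨a, ha⟩ : (s.1 ∆ t.1).Nonempty := Finset.card_pos.1 (by omega)
    rcases Finset.mem_symmDiff.1 ha with ⟨h1, h2⟩ | ⟨h1, h2⟩
    · obtain ⟨s', hs', hc⟩ := erase s t a h1 h2
      have := ih s' t (by omega)
      calc K.edist s t ≤ K.edist s s' + K.edist s' t := SimpleGraph.edist_triangle
        _ ≤ 1 + n := by rw [edist_eq_one_iff_adj.2 hs']; gcongr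
        _ = _ := by push_cast; ring
    · obtain ⟨t', ht', hc⟩ := erase t s a h1 h2
      rw [symmDiff_comm, symmDiff_comm t.1] at hc
      have := ih s t' (by omega)
      calc K.edist s t ≤ K.edist s t' + K.edist t' t := SimpleGraph.edist_triangle
        _ ≤ n + 1 := by rw [K.edist_comm (u := t'), edist_eq_one_iff_adj.2 ht']; gcongr
        _ = _ := by push_cast; ring

theorem hypercube_edist [DecidableEq X] (s t : Finset X) :
    (hypercube X).edist s t = (s ∆ t).card := by
  refine le_antisymm ?_ (card_symmDiff_le_edist s t)
  rw [← edist_eq_card_symmDiff_of_isLowerSet (P := fun _ : Finset X => True)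
    (fun _ _ _ _ => trivial) (K := (hypercube X).comap Subtype.val) (fun _ _ => Iff.rfl)
    ⟨s, trivial⟩ ⟨t, trivial⟩]
  exact edist_map_le (G := (hypercube X).comap Subtype.val) Subtype.val (fun _ _ h => h) _ _

theorem simplexGraph_edist [DecidableEq X] {F : SimpleGraph X}
    (s t : {s : Finset X // F.IsClique s}) :
    (simplexGraph F).edist s t = (s.1 ∆ t.1).card :=
  edist_eq_card_symmDiff_of_isLowerSet
    (fun _ _ h ht => ht.subset (by exact_mod_cast h)) (fun _ _ => Iff.rfl) s t

theorem cubeMinusVertex_edist (s t : {s : Finset (Fin 3) // s ≠ Finset.univ}) :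
    cubeMinusVertex.edist s t = (s.1 ∆ t.1).card :=
  edist_eq_card_symmDiff_of_isLowerSet
    (fun s t h ht hs => ht (Finset.univ_subset_iff.1 (by rwa [hs] at h))) (fun _ _ => Iff.rfl) s t

end Hypercube

/-! ### Local characterization of median graphs. -/

section LocalMedian

variable {V : Type u} {G : SimpleGraph V}

/-- No vertex is equidistant from the two ends of an edge. -/
def NoEquidistantEdge (G : SimpleGraph V) : Prop :=
  ∀ z u v : V, G.Adj u v → G.dist z u ≠ G.dist z v

/-- The quadrangle condition at the vertices of level at most `n` over the base vertex `b`. -/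
def QuadrangleUpTo (G : SimpleGraph V) (b : V) (n : ℕ) : Prop :=
  ∀ x y₁ y₂ : V, G.dist b x ≤ n → G.Adj x y₁ → G.Adj x y₂ → y₁ ≠ y₂ →
    G.dist b x = G.dist b y₁ + 1 → G.dist b x = G.dist b y₂ + 1 →
    ∃ z, G.Adj y₁ z ∧ G.Adj y₂ z ∧ G.dist b x = G.dist b z + 2

/-- A local description of median graphs. -/
structure IsLocallyMedian (G : SimpleGraph V) : Prop where
  connected : G.Connected
  bip : NoEquidistantEdge G
  quad : ∀ b n, QuadrangleUpTo G b n
  thin : ∀ x v a b c : V, x ≠ v → a ≠ b → b ≠ c → a ≠ c → G.Adj x a → G.Adj x b → G.Adj x c →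
    G.Adj v a → G.Adj v b → G.Adj v c → False

theorem NoEquidistantEdge.dist_cases (hb : NoEquidistantEdge G) (hG : G.Connected) {u v : V}
    (h : G.Adj u v) (z : V) : G.dist z u = G.dist z v + 1 ∨ G.dist z v = G.dist z u + 1 := by
  have h1 := dist_le_succ_of_adj hG h z
  have h2 := dist_le_succ_of_adj hG h.symm z
  have h3 := hb z u v h
  omega

theorem NoEquidistantEdge.not_adj (hb : NoEquidistantEdge G) {x a b : V} (ha : G.Adj x a)
    (hb' : G.Adj x b) : ¬ G.Adj a b := by
  intro h
  exact hb x a b h (by rw [dist_eq_one_iff_adj.2 ha, dist_eq_one_iff_adj.2 hb'])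

theorem mem_interval_of_le (hG : G.Connected) {x y z : V}
    (h : G.dist x z + G.dist z y ≤ G.dist x y) : z ∈ interval G x y :=
  le_antisymm hG.dist_triangle h

theorem interval_comm (x y : V) : interval G x y = interval G y x := by
  ext z
  simp only [interval, Set.mem_ofPred_eq]
  rw [G.dist_comm (u := x) (v := y), G.dist_comm (u := x) (v := z), G.dist_comm (u := z) (v := y)]
  omega

/-- Levels over `u` must drop at every step of a geodesic from `v` to the lowest point `m`. If the
first step went up to `v₁`, the quadrangle condition at `v₁` would replace it by a vertex `q` two
levels lower in the same interval and equally far from `m`, against the induction hypothesis. -/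
theorem dist_eq_add_of_forall_interval (hG : G.Connected) (hb : NoEquidistantEdge G) {u : V} {n : ℕ}
    (hq : QuadrangleUpTo G u n) (m : V) (k : ℕ) (v : V) (hk : G.dist v m = k)
    (hmin : ∀ p ∈ interval G v m, G.dist u p ≤ n ∧ G.dist u m ≤ G.dist u p) :
    G.dist u v = k + G.dist u m := by
  induction k using Nat.strong_induction_on generalizing v with
  | _ k ih =>
  by_cases hvm : v = m
  · subst hvm
    rw [G.dist_self] at hk
    omega
  have sub : ∀ w, G.dist v m = G.dist v w + G.dist w m → ∀ p ∈ interval G w m,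
      p ∈ interval G v m := by
    intro w hw p hp
    have hp : G.dist w m = G.dist w p + G.dist p m := hp
    have := hG.dist_triangle (u := v) (v := w) (w := p)
    exact mem_interval_of_le hG (by omega)
  obtain ⟨v₁, hv₁, hd₁⟩ := exists_adj_dist_eq_succ hG hvm
  have hvv₁ : G.dist v v₁ = 1 := dist_eq_one_iff_adj.2 hv₁
  have e₁ := ih (G.dist v₁ m) (by omega) v₁ rfl
    fun p hp => hmin p (sub v₁ (by omega) p hp)
  rcases hb.dist_cases hG hv₁ u with h | h
  · omega
  · have hv := (hmin v (mem_interval_of_le hG (by rw [G.dist_self]; omega))).2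
    by_cases hv₁m : v₁ = m
    · subst hv₁m; omega
    obtain ⟨v₂, hv₂, hd₂⟩ := exists_adj_dist_eq_succ hG hv₁m
    have hvv₂ : G.dist v v₂ ≤ 2 := by
      have := dist_le_succ_of_adj hG hv₂.symm v
      omega
    have i₂ : v₂ ∈ interval G v m := mem_interval_of_le hG (by omega)
    have e₂ := ih (G.dist v₂ m) (by omega) v₂ rfl
      fun p hp => hmin p (sub v₂ i₂ p hp)
    have hne : v ≠ v₂ := by rintro rfl; omega
    have i₁ : v₁ ∈ interval G v m := mem_interval_of_le hG (by omega)
    obtain ⟨q, hq₁, hq₂, hqd⟩ := hq v₁ v v₂ (hmin v₁ i₁).1 hv₁.symm hv₂ hne h (by omega)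
    have t₁ := dist_le_succ_of_adj hG hq₁ m
    have t₂ := dist_le_succ_of_adj hG hq₂.symm m
    rw [G.dist_comm (u := m), G.dist_comm (u := m)] at t₁ t₂
    have hvq : G.dist v q = 1 := dist_eq_one_iff_adj.2 hq₁
    have iq : q ∈ interval G v m := mem_interval_of_le hG (by omega)
    have eq := ih (G.dist q m) (by omega) q rfl fun p hp => hmin p (sub q iq p hp)
    omega

/-- The median is a point of `I(v, w)` nearest to `u`. The quadrangle condition is needed only up to
the levels occurring in that interval, so the lemma is available inside an induction that
establishes this condition. -/
theorem exists_median_of_quadrangleUpTo (hG : G.Connected) (hb : NoEquidistantEdge G) {u : V}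
    {n : ℕ}
    (hq : QuadrangleUpTo G u n) (v w : V) (hn : ∀ p ∈ interval G v w, G.dist u p ≤ n) :
    ∃ m ∈ interval G v w, G.dist u v = G.dist v m + G.dist u m ∧
      G.dist u w = G.dist w m + G.dist u m := by
  have hex : ∃ d, ∃ m ∈ interval G v w, G.dist u m = d :=
    ⟨_, v, mem_interval_of_le hG (by rw [G.dist_self]; omega), rfl⟩
  classical
  obtain ⟨m, hm, hd⟩ := Nat.find_spec hex
  have hmin : ∀ p ∈ interval G v w, G.dist u m ≤ G.dist u p :=
    fun p hp => hd.trans_le (Nat.find_min' hex ⟨p, hp, rfl⟩)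
  have hm' : G.dist v w = G.dist v m + G.dist m w := hm
  refine ⟨m, hm, dist_eq_add_of_forall_interval hG hb hq m _ v rfl ?_,
    dist_eq_add_of_forall_interval hG hb hq m _ w rfl ?_⟩
  · intro p hp
    have hp' : G.dist v m = G.dist v p + G.dist p m := hp
    have := hG.dist_triangle (u := p) (v := m) (w := w)
    have hp : p ∈ interval G v w := mem_interval_of_le hG (by omega)
    exact ⟨hn p hp, hmin p hp⟩
  · intro p hp
    have hp' : G.dist w m = G.dist w p + G.dist p m := hp
    have := hG.dist_triangle (u := v) (v := m) (w := p)
    have hp : p ∈ interval G v w := mem_interval_of_le hG (by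
      rw [G.dist_comm (u := p) (v := w)]
      rw [G.dist_comm (u := w) (v := m), G.dist_comm (u := p) (v := m)] at hp'
      omega)
    exact ⟨hn p hp, hmin p hp⟩

theorem IsMedian.isLocallyMedian (h : IsMedian G) : IsLocallyMedian G := by
  obtain ⟨hG, hmed⟩ := h
  have hbip : NoEquidistantEdge G := by
    intro z u v huv hz
    obtain ⟨m, hm⟩ := hmed u v z
    have hmem : m ∈ medianSet G u v z := by rw [hm]; rfl
    obtain ⟨⟨h1, h2⟩, h3⟩ := hmem
    have h1 : G.dist u v = G.dist u m + G.dist m v := h1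
    have h2 : G.dist v z = G.dist v m + G.dist m z := h2
    have h3 : G.dist z u = G.dist z m + G.dist m u := h3
    rw [dist_eq_one_iff_adj.2 huv] at h1
    rw [G.dist_comm (u := v) (v := z), G.dist_comm (u := v) (v := m),
      G.dist_comm (u := m) (v := z)] at h2
    rw [G.dist_comm (u := u) (v := m)] at h1
    omega
  have two : ∀ x a b, G.Adj x a → G.Adj x b → a ≠ b → G.dist a b = 2 := by
    intro x a b ha hb hab
    have h1 := dist_le_succ_of_adj hG hb.symm a
    have h2 := hbip a x b hb
    have h3 : G.dist a x = 1 := dist_eq_one_iff_adj.2 ha.symm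
    have h4 := hG.pos_dist_of_ne hab
    omega
  refine ⟨hG, hbip, ?_, ?_⟩
  · intro b n x y₁ y₂ _ h₁ h₂ hne d₁ d₂
    obtain ⟨m, hm⟩ := hmed y₁ y₂ b
    have hmem : m ∈ medianSet G y₁ y₂ b := by rw [hm]; rfl
    obtain ⟨⟨h1, h2⟩, h3⟩ := hmem
    have h1 : G.dist y₁ y₂ = G.dist y₁ m + G.dist m y₂ := h1
    have h2 : G.dist y₂ b = G.dist y₂ m + G.dist m b := h2
    have h3 : G.dist b y₁ = G.dist b m + G.dist m y₁ := h3
    rw [two x y₁ y₂ h₁ h₂ hne] at h1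
    rw [G.dist_comm (u := y₂) (v := b), G.dist_comm (u := m) (v := b)] at h2
    rw [G.dist_comm (u := m) (v := y₁)] at h3
    rw [G.dist_comm (u := m) (v := y₂)] at h1
    exact ⟨m, dist_eq_one_iff_adj.1 (by omega), dist_eq_one_iff_adj.1 (by omega), by omega⟩
  · intro x v a b c hxv hab hbc hac xa xb xc va vb vc
    obtain ⟨m, hm⟩ := hmed a b c
    have mem : ∀ y, G.Adj y a → G.Adj y b → G.Adj y c → y ∈ medianSet G a b c := by
      intro y ya yb yc
      have a1 : G.dist a y = 1 := dist_eq_one_iff_adj.2 ya.symm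
      have b1 : G.dist b y = 1 := dist_eq_one_iff_adj.2 yb.symm
      have c1 : G.dist c y = 1 := dist_eq_one_iff_adj.2 yc.symm
      have a2 : G.dist y a = 1 := dist_eq_one_iff_adj.2 ya
      have b2 : G.dist y b = 1 := dist_eq_one_iff_adj.2 yb
      have c2 : G.dist y c = 1 := dist_eq_one_iff_adj.2 yc
      refine ⟨⟨?_, ?_⟩, ?_⟩
      · exact mem_interval_of_le hG (by rw [two x a b xa xb hab]; omega)
      · exact mem_interval_of_le hG (by rw [two x b c xb xc hbc]; omega)
      · exact mem_interval_of_le hG (by rw [two x c a xc xa hac.symm]; omega)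
    have e1 := mem x xa xb xc
    have e2 := mem v va vb vc
    rw [hm] at e1 e2
    exact hxv (e1.trans e2.symm)

end LocalMedian

/-! ### Halfspaces and ladders of squares. -/

section Halfspaces

variable {V : Type u} {G : SimpleGraph V}

/-- The vertices that are closer to `x` than to `y`. -/
def nearer (G : SimpleGraph V) (x y : V) : Set V := {z | G.dist z x < G.dist z y}

/-- The pair `f` is the side opposite to `e` in a square, with the corresponding orientation. -/
def OppositeSides (G : SimpleGraph V) (e f : V × V) : Prop :=
  G.Adj e.1 e.2 ∧ G.Adj f.1 f.2 ∧ G.Adj e.1 f.1 ∧ G.Adj e.2 f.2 ∧ e.1 ≠ f.2 ∧ e.2 ≠ f.1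

theorem OppositeSides.symm {e f : V × V} (h : OppositeSides G e f) : OppositeSides G f e :=
  ⟨h.2.1, h.1, h.2.2.1.symm, h.2.2.2.1.symm, h.2.2.2.2.2.symm, h.2.2.2.2.1.symm⟩

theorem exists_adj_mem_notMem (hG : G.Connected) {A : Set V} {u w : V} (hu : u ∈ A) (hw : w ∉ A) :
    ∃ p p', G.Adj p p' ∧ p ∈ A ∧ p' ∉ A ∧ G.dist u w = G.dist u p + 1 + G.dist p' w := by
  induction hn : G.dist u w generalizing u with
  | zero => exact absurd ((hG.dist_eq_zero_iff.1 hn) ▸ hu) hw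
  | succ n ih =>
    obtain ⟨u', hu', hd⟩ := exists_adj_dist_eq_succ hG (x := u) (y := w)
      (by rintro rfl; exact hw hu)
    by_cases h : u' ∈ A
    · obtain ⟨p, p', hpp, hp, hp', hd'⟩ := ih h (by omega)
      refine ⟨p, p', hpp, hp, hp', ?_⟩
      have h1 : G.dist u u' = 1 := dist_eq_one_iff_adj.2 hu'
      have h2 := hG.dist_triangle (u := u) (v := u') (w := p)
      have h3 := hG.dist_triangle (u := u) (v := p) (w := w)
      have h4 := hG.dist_triangle (u := p) (v := p') (w := w)
      have h5 : G.dist p p' = 1 := dist_eq_one_iff_adj.2 hpp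
      omega
    · exact ⟨u, u', hu', hu, h, by rw [G.dist_self]; omega⟩

namespace IsLocallyMedian

theorem dist_cases (hM : IsLocallyMedian G) {u v : V} (h : G.Adj u v) (z : V) :
    G.dist z u = G.dist z v + 1 ∨ G.dist z v = G.dist z u + 1 :=
  hM.bip.dist_cases hM.connected h z

theorem not_adj_of_common (hM : IsLocallyMedian G) {x a b : V} (ha : G.Adj x a)
    (hb : G.Adj x b) : ¬ G.Adj a b :=
  hM.bip.not_adj ha hb

theorem compl_nearer (hM : IsLocallyMedian G) {x y : V} (h : G.Adj x y) :
    (nearer G x y)ᶜ = nearer G y x := by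
  ext z
  have := hM.dist_cases h z
  simp only [nearer, Set.mem_compl_iff, Set.mem_ofPred_eq]
  omega

/-- If `z` were nearer to `x` than to `y` but not nearer to `u` than to `v`, then `x` and `v` would
be at one level over `z`, with `u` and `y` above them. The quadrangle condition would add a common
neighbour below, completing a `K_{2,3}`. -/
theorem nearer_subset_of_oppositeSides (hM : IsLocallyMedian G) {e f : V × V}
    (h : OppositeSides G e f) :
    nearer G e.1 e.2 ⊆ nearer G f.1 f.2 := by
  obtain ⟨x, y⟩ := e
  obtain ⟨u, v⟩ := f
  obtain ⟨hxy, huv, hxu, hyv, hxv, hyu⟩ := h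
  simp only at *
  intro z hz
  have hz : G.dist z x < G.dist z y := hz
  by_contra hz'
  have hz' : ¬ G.dist z u < G.dist z v := hz'
  have d1 := hM.dist_cases hxy z
  have d2 := hM.dist_cases huv z
  have d3 := hM.dist_cases hxu z
  have d4 := hM.dist_cases hyv z
  obtain ⟨t, hxt, hvt, hd⟩ := hM.quad z _ y x v le_rfl hxy.symm hyv hxv (by omega) (by omega)
  refine hM.thin x v u y t hxv hyu.symm ?_ ?_ hxu hxy hxt huv.symm hyv.symm hvt
  · rintro rfl; omega
  · rintro rfl; omega

theorem nearer_eq_of_oppositeSides (hM : IsLocallyMedian G) {e f : V × V}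
    (h : OppositeSides G e f) :
    nearer G e.1 e.2 = nearer G f.1 f.2 :=
  (hM.nearer_subset_of_oppositeSides h).antisymm (hM.nearer_subset_of_oppositeSides h.symm)

/-- Any two edges crossing the same cut are joined by a ladder of squares. -/
theorem exists_ladder (hM : IsLocallyMedian G) {x y u v : V} (hxy : G.Adj x y) (huv : G.Adj u v)
    (hu : u ∈ nearer G x y)
    (hv : v ∉ nearer G x y) : Relation.ReflTransGen (OppositeSides G) (x, y) (u, v) := by
  change G.dist u x < G.dist u y at hu
  change ¬ G.dist v x < G.dist v y at hv
  induction hn : G.dist u x generalizing u v with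
  | zero =>
    have hux := hM.connected.dist_eq_zero_iff.1 hn
    subst hux
    have h1 : G.dist v u = 1 := dist_eq_one_iff_adj.2 huv.symm
    have d1 := hM.dist_cases hxy v
    have : v = y := hM.connected.dist_eq_zero_iff.1 (by omega)
    subst this
    exact Relation.ReflTransGen.refl
  | succ n ih =>
    have hne : u ≠ x := by rintro rfl; rw [G.dist_self] at hn; omega
    obtain ⟨u', huu', hd⟩ := exists_adj_dist_eq_succ hM.connected hne
    have d1 := hM.dist_cases hxy u
    have d2 := hM.dist_cases hxy v
    have d3 := hM.dist_cases huv x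
    have d4 := hM.dist_cases huv y
    have d5 := hM.dist_cases huu' y
    have d6 := hM.dist_cases hxy u'
    rw [G.dist_comm (u := x), G.dist_comm (u := x)] at d3
    rw [G.dist_comm (u := y), G.dist_comm (u := y)] at d4 d5
    have hu'v : u' ≠ v := by rintro rfl; omega
    -- Seen from `y`, both `u'` and `v` are one level below `u`. The vertex `v'` under them
    -- completes a square, whose side `u'v'` is the preceding rung.
    obtain ⟨v', h1, h2, h3⟩ := hM.quad y _ u u' v le_rfl huu' huv hu'v
      (by rw [G.dist_comm (u := y), G.dist_comm (u := y)]; omega)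
      (by rw [G.dist_comm (u := y), G.dist_comm (u := y)]; omega)
    rw [G.dist_comm (u := y), G.dist_comm (u := y)] at h3
    have d7 := hM.dist_cases hxy v'
    have d8 := hM.dist_cases h2 x
    have d9 := hM.dist_cases h1 x
    rw [G.dist_comm (u := x), G.dist_comm (u := x)] at d8 d9
    refine (ih h1 (by omega) (by omega) (by omega)).tail
      ⟨h1, huv, huu'.symm, h2.symm, hu'v, ?_⟩
    intro h
    have h : v' = u := h
    subst h
    omega

theorem nearer_eq_of_crossing (hM : IsLocallyMedian G) {x y u v : V} (hxy : G.Adj x y)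
    (huv : G.Adj u v)
    (hu : u ∈ nearer G x y) (hv : v ∉ nearer G x y) : nearer G x y = nearer G u v := by
  have : ∀ f : V × V, Relation.ReflTransGen (OppositeSides G) (x, y) f →
      nearer G x y = nearer G f.1 f.2 := by
    intro f hf
    induction hf with
    | refl => rfl
    | tail _ h ih => rw [ih, hM.nearer_eq_of_oppositeSides h]
  exact this (u, v) (hM.exists_ladder hxy huv hu hv)

/-- A geodesic that left the set through `pp'` and returned through `q'q` could be shortened: `pp'`
cuts off the same set, so `q` is nearer to `p` than to `p'`. -/
theorem isConvex_nearer (hM : IsLocallyMedian G) {x y : V} (hxy : G.Adj x y) :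
    IsConvex G (nearer G x y) := by
  intro u hu v hv w hw
  by_contra hwA
  have hw : G.dist u v = G.dist u w + G.dist w v := hw
  obtain ⟨p, p', hpp, hp, hp', hd⟩ := exists_adj_mem_notMem hM.connected hu hwA
  obtain ⟨q, q', hqq, hq, hq', hd'⟩ := exists_adj_mem_notMem hM.connected hv hwA
  have e := hM.nearer_eq_of_crossing hxy hpp hp hp'
  rw [e] at hq
  have hq : G.dist q p < G.dist q p' := hq
  have t1 := hM.connected.dist_triangle (u := u) (v := p) (w := v)
  have t2 := hM.connected.dist_triangle (u := p) (v := q) (w := v)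
  have t3 := hM.connected.dist_triangle (u := q) (v := q') (w := p')
  have t4 := hM.connected.dist_triangle (u := q') (v := w) (w := p')
  have t5 : G.dist q q' = 1 := dist_eq_one_iff_adj.2 hqq
  rw [G.dist_comm (u := w) (v := v)] at hw
  rw [G.dist_comm (u := q) (v := v), G.dist_comm (u := p) (v := q)] at t2
  rw [G.dist_comm (u := w) (v := p')] at t4
  omega

end IsLocallyMedian

/-- A halfspace: a convex set with a convex complement. -/
def IsHalfspace (G : SimpleGraph V) (A : Set V) : Prop := IsConvex G A ∧ IsConvex G Aᶜ

theorem IsHalfspace.compl {A : Set V} (h : IsHalfspace G A) : IsHalfspace G Aᶜ :=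
  ⟨h.2, by rw [compl_compl]; exact h.1⟩

namespace IsLocallyMedian

theorem isHalfspace_nearer (hM : IsLocallyMedian G) {x y : V} (hxy : G.Adj x y) :
    IsHalfspace G (nearer G x y) :=
  ⟨hM.isConvex_nearer hxy, by rw [hM.compl_nearer hxy]; exact hM.isConvex_nearer hxy.symm⟩

theorem mem_nearer {x y : V} (hxy : G.Adj x y) : x ∈ nearer G x y ∧ y ∉ nearer G x y := by
  have h : G.dist x y = 1 := dist_eq_one_iff_adj.2 hxy
  have h' : G.dist y x = 1 := dist_eq_one_iff_adj.2 hxy.symm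
  simp [nearer, h, h']

/-- A single cut edge determines the halfspace: a point of `A` nearer to `y` would have `y` on a
geodesic to `x`, against convexity, and likewise in the complement. -/
theorem eq_nearer_of_isHalfspace (hM : IsLocallyMedian G) {x y : V} (hxy : G.Adj x y) {A : Set V}
    (hA : IsHalfspace G A)
    (hx : x ∈ A) (hy : y ∉ A) : A = nearer G x y := by
  have h1 : G.dist x y = 1 := dist_eq_one_iff_adj.2 hxy
  have h2 : G.dist y x = 1 := dist_eq_one_iff_adj.2 hxy.symm
  ext z
  have d := hM.dist_cases hxy z
  constructor
  · intro hz
    by_contra hz'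
    have hz' : ¬ G.dist z x < G.dist z y := hz'
    exact hy (hA.1 z hz x hx (show G.dist z x = G.dist z y + G.dist y x by omega))
  · intro hz
    have hz : G.dist z x < G.dist z y := hz
    by_contra hz'
    exact hA.2 z hz' y hy (show G.dist z y = G.dist z x + G.dist x y by omega) hx

theorem exists_isHalfspace_separating (hM : IsLocallyMedian G) {u v : V} (huv : u ≠ v) :
    ∃ A, IsHalfspace G A ∧ u ∈ A ∧ v ∉ A := by
  obtain ⟨u', hu', hd⟩ := exists_adj_dist_eq_succ hM.connected huv
  refine ⟨nearer G u u', hM.isHalfspace_nearer hu', (mem_nearer hu').1, ?_⟩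
  change ¬ G.dist v u < G.dist v u'
  rw [G.dist_comm (u := v), G.dist_comm (u := v)]
  omega

theorem isMedian (hM : IsLocallyMedian G) : IsMedian G := by
  refine ⟨hM.connected, fun x y z => ?_⟩
  obtain ⟨m, hm, h1, h2⟩ := exists_median_of_quadrangleUpTo hM.connected hM.bip (u := x)
    (n := G.dist x y + G.dist y z) (hM.quad _ _) y z (by
      intro p hp
      have hp : G.dist y z = G.dist y p + G.dist p z := hp
      have := hM.connected.dist_triangle (u := x) (v := y) (w := p)
      omega)
  have hmem : m ∈ medianSet G x y z := by
    refine ⟨⟨?_, hm⟩, ?_⟩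
    · rw [interval_comm]
      refine mem_interval_of_le hM.connected ?_
      rw [G.dist_comm (u := y) (v := x), G.dist_comm (u := m) (v := x)]
      omega
    · refine mem_interval_of_le hM.connected ?_
      rw [G.dist_comm (u := z) (v := x), G.dist_comm (u := m) (v := x)]
      omega
  refine ⟨m, Set.eq_singleton_iff_unique_mem.2 ⟨hmem, fun m' hmem' => ?_⟩⟩
  by_contra hne
  obtain ⟨A, hA, hmA, hm'A⟩ := hM.exists_isHalfspace_separating (Ne.symm hne)
  -- Majority rule: a halfspace or its complement contains two of `x`, `y`, `z`, hence all their
  -- medians, so no halfspace separates two medians.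
  have maj : ∀ B : Set V, IsConvex G B → ∀ q ∈ medianSet G x y z,
      (x ∈ B ∧ y ∈ B ∨ y ∈ B ∧ z ∈ B ∨ z ∈ B ∧ x ∈ B) → q ∈ B := by
    rintro B hB q ⟨⟨q1, q2⟩, q3⟩ (⟨a, b⟩ | ⟨a, b⟩ | ⟨a, b⟩)
    · exact hB _ a _ b q1
    · exact hB _ a _ b q2
    · exact hB _ a _ b q3
  have h1 := maj A hA.1 m' hmem'
  have h2 := maj Aᶜ hA.2 m hmem
  rw [Set.mem_compl_iff, Set.mem_compl_iff, Set.mem_compl_iff] at h2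
  by_cases hx : x ∈ A <;> by_cases hy : y ∈ A <;> by_cases hz : z ∈ A <;>
    simp only [hx, hy, hz, not_true, not_false_iff, and_true, and_false, or_true,
      or_false, true_implies] at h1 h2 <;> first | exact hm'A h1 | exact h2 hmA

end IsLocallyMedian

end Halfspaces

/-! ### Halfspaces as coordinates in a hypercube. -/

section CubeEmbedding

variable {V : Type u} {G : SimpleGraph V}

/-- The halfspaces avoiding a base vertex: one side of each convex split, and the empty set. -/
def HalfspaceAvoiding (G : SimpleGraph V) (b : V) : Type u :=
  {A : Set V // IsHalfspace G A ∧ b ∉ A}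

namespace IsLocallyMedian

theorem exists_unique_separating (hM : IsLocallyMedian G) (b : V) {x y : V} (hxy : G.Adj x y) :
    ∃ A : HalfspaceAvoiding G b, ∀ B : HalfspaceAvoiding G b, ¬ (x ∈ B.1 ↔ y ∈ B.1) ↔ B = A := by
  obtain ⟨h1, h2⟩ := mem_nearer hxy
  by_cases hb : b ∈ nearer G x y
  · refine ⟨⟨(nearer G x y)ᶜ, (hM.isHalfspace_nearer hxy).compl, by simpa using hb⟩, fun B => ?_⟩
    constructor
    · intro hB
      apply Subtype.ext
      change B.1 = (nearer G x y)ᶜ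
      by_cases hx : x ∈ B.1
      · have hy : y ∉ B.1 := by tauto
        have := hM.eq_nearer_of_isHalfspace hxy B.2.1 hx hy
        exact absurd (this ▸ hb) B.2.2
      · have hy : y ∈ B.1 := by tauto
        rw [hM.compl_nearer hxy]
        exact hM.eq_nearer_of_isHalfspace hxy.symm B.2.1 hy hx
    · rintro rfl
      change ¬ (x ∈ (nearer G x y)ᶜ ↔ y ∈ (nearer G x y)ᶜ)
      simp [h1, h2]
  · refine ⟨⟨nearer G x y, hM.isHalfspace_nearer hxy, hb⟩, fun B => ?_⟩
    constructor
    · intro hB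
      apply Subtype.ext
      change B.1 = nearer G x y
      by_cases hx : x ∈ B.1
      · have hy : y ∉ B.1 := by tauto
        exact hM.eq_nearer_of_isHalfspace hxy B.2.1 hx hy
      · have hy : y ∈ B.1 := by tauto
        have := hM.eq_nearer_of_isHalfspace hxy.symm B.2.1 hy hx
        have hb' : b ∈ (nearer G x y)ᶜ := hb
        rw [hM.compl_nearer hxy] at hb'
        exact absurd (this ▸ hb') B.2.2
    · rintro rfl
      change ¬ (x ∈ nearer G x y ↔ y ∈ nearer G x y)
      simp [h1, h2]

theorem finite_halfspaces_mem (hM : IsLocallyMedian G) (b v : V) :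
    {A : HalfspaceAvoiding G b | v ∈ A.1}.Finite := by
  obtain ⟨p⟩ := hM.connected v b
  induction p with
  | nil =>
    convert Set.finite_empty
    ext A
    simpa using A.2.2
  | cons h p ih =>
    obtain ⟨A, hA⟩ := hM.exists_unique_separating _ h
    refine (ih.union (Set.finite_singleton A)).subset fun B hB => ?_
    by_cases hBA : B = A
    · right; exact hBA
    · left
      have := (hA B).not.2 hBA
      rw [not_not] at this
      exact this.1 hB

/-- The finite set of halfspaces avoiding `b` that contain `v`. -/
noncomputable def cubeVertex (hM : IsLocallyMedian G) (b v : V) : Finset (HalfspaceAvoiding G b) :=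
  (hM.finite_halfspaces_mem b v).toFinset

theorem mem_cubeVertex (hM : IsLocallyMedian G) {b v : V} {A : HalfspaceAvoiding G b} :
    A ∈ hM.cubeVertex b v ↔ v ∈ A.1 := by
  simp [cubeVertex]

theorem cubeVertex_self (hM : IsLocallyMedian G) (b : V) : hM.cubeVertex b b = ∅ := by
  ext A
  simpa [mem_cubeVertex] using A.2.2

theorem mem_symmDiff_cubeVertex {b : V} [DecidableEq (HalfspaceAvoiding G b)]
    (hM : IsLocallyMedian G)
    {u v : V} {A : HalfspaceAvoiding G b} :
    A ∈ hM.cubeVertex b u ∆ hM.cubeVertex b v ↔ ¬ (u ∈ A.1 ↔ v ∈ A.1) := by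
  rw [Finset.mem_symmDiff, mem_cubeVertex, mem_cubeVertex]
  tauto

theorem symmDiff_cubeVertex_of_adj {b : V} [DecidableEq (HalfspaceAvoiding G b)]
    (hM : IsLocallyMedian G)
    {x y : V} (hxy : G.Adj x y) :
    ∃ A, hM.cubeVertex b x ∆ hM.cubeVertex b y = {A} := by
  obtain ⟨A, hA⟩ := hM.exists_unique_separating b hxy
  refine ⟨A, Finset.ext fun B => ?_⟩
  rw [mem_symmDiff_cubeVertex, hA, Finset.mem_singleton]

/-- The halfspace crossed by the first step of a geodesic is, by convexity, not crossed again, so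
each step uses up a new separating halfspace. -/
theorem dist_le_card_symmDiff {b : V} [DecidableEq (HalfspaceAvoiding G b)] (hM : IsLocallyMedian G)
    (u v : V) : G.dist u v ≤ (hM.cubeVertex b u ∆ hM.cubeVertex b v).card := by
  induction hn : G.dist u v generalizing u with
  | zero => exact Nat.zero_le _
  | succ n ih =>
    have hne : u ≠ v := by rintro rfl; rw [G.dist_self] at hn; omega
    obtain ⟨u', hu', hd⟩ := exists_adj_dist_eq_succ hM.connected hne
    have h1 : G.dist u u' = 1 := dist_eq_one_iff_adj.2 hu'
    have hint : u' ∈ interval G u v := mem_interval_of_le hM.connected (by omega)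
    obtain ⟨A, hA⟩ := hM.exists_unique_separating b hu'
    have hAs := (hA A).2 rfl
    have hnot : A ∉ hM.cubeVertex b u' ∆ hM.cubeVertex b v := by
      rw [mem_symmDiff_cubeVertex, not_not]
      by_cases hu : u ∈ A.1 <;> by_cases hv : v ∈ A.1
      · exact absurd (iff_of_true hu (A.2.1.1 u hu v hv hint)) hAs
      · tauto
      · tauto
      · have : u' ∉ A.1 := A.2.1.2 u hu v hv hint
        tauto
    have hsub : insert A (hM.cubeVertex b u' ∆ hM.cubeVertex b v) ⊆
        hM.cubeVertex b u ∆ hM.cubeVertex b v := by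
      intro B hB
      rw [Finset.mem_insert] at hB
      rw [mem_symmDiff_cubeVertex]
      by_cases hBA : B = A
      · subst hBA
        rw [mem_symmDiff_cubeVertex] at hnot
        tauto
      · have hB' := (hA B).not.2 hBA
        have := hB.resolve_left hBA
        rw [mem_symmDiff_cubeVertex] at this
        tauto
    have := Finset.card_le_card hsub
    rw [Finset.card_insert_of_notMem hnot] at this
    have := ih u' (by omega)
    omega

theorem isIsometric_of_dist_le {W : Type v} {H : SimpleGraph W} (hG : G.Connected) {f : V → W}
    (hf : ∀ x y, G.Adj x y → H.Adj (f x) (f y))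
    (hd : ∀ x y, (G.dist x y : ℕ∞) ≤ H.edist (f x) (f y)) : IsIsometric G H f := fun x y =>
  le_antisymm (edist_map_le f hf x y) (by rw [← (hG x y).coe_dist_eq_edist]; exact hd x y)

theorem isIsometric_cubeVertex (hM : IsLocallyMedian G) (b : V) :
    IsIsometric G (hypercube (HalfspaceAvoiding G b)) (hM.cubeVertex b) := by
  classical
  refine isIsometric_of_dist_le hM.connected (fun x y hxy => ?_) (fun x y => ?_)
  · obtain ⟨A, hA⟩ := hM.symmDiff_cubeVertex_of_adj (b := b) hxy
    rw [hypercube_adj_iff, hA, Finset.card_singleton]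
  · rw [hypercube_edist, Nat.cast_le]
    exact hM.dist_le_card_symmDiff x y

theorem isIsometricSubgraph_hypercube (hM : IsLocallyMedian G) :
    ∃ X : Type u, IsIsometricSubgraph G (hypercube X) :=
  ⟨_, _, hM.isIsometric_cubeVertex hM.connected.nonempty.some⟩

end IsLocallyMedian

end CubeEmbedding

/-! ### Trees from families of non-crossing halfspaces. -/

section Trees

variable {V : Type u} {G : SimpleGraph V} {b : V}

/-- All four corners cut out by two sets of vertices are nonempty. -/
def Crosses (A B : Set V) : Prop :=
  (A ∩ B).Nonempty ∧ (A ∩ Bᶜ).Nonempty ∧ (Aᶜ ∩ B).Nonempty ∧ (Aᶜ ∩ Bᶜ).Nonempty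

namespace IsLocallyMedian

open Classical in
/-- The image of a vertex in the quotient of the graph defined by the halfspaces in `S`. -/
noncomputable def quotientVertex (hM : IsLocallyMedian G) (b : V)
    (S : Set (HalfspaceAvoiding G b)) (v : V) : Finset (HalfspaceAvoiding G b) :=
  (hM.cubeVertex b v).filter (· ∈ S)

/-- The quotient of the graph defined by the halfspaces in `S`, as a subgraph of a hypercube. -/
def quotientGraph (hM : IsLocallyMedian G) (b : V) (S : Set (HalfspaceAvoiding G b)) :
    SimpleGraph (Set.range (hM.quotientVertex b S)) :=
  (hypercube _).comap Subtype.val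

theorem mem_quotientVertex (hM : IsLocallyMedian G) {S : Set (HalfspaceAvoiding G b)} {v : V}
    {A : HalfspaceAvoiding G b} : A ∈ hM.quotientVertex b S v ↔ v ∈ A.1 ∧ A ∈ S := by
  simp [quotientVertex, mem_cubeVertex]

/-- The crossed halfspace `A` is chosen before `S`, so that one `A` serves a colour class and its
complement: each edge moves in exactly one of the two quotients. -/
theorem quotientVertex_of_adj (hM : IsLocallyMedian G) {x y : V} (hxy : G.Adj x y) :
    ∃ A : HalfspaceAvoiding G b, ∀ S,
      (A ∈ S → (hypercube _).Adj (hM.quotientVertex b S x) (hM.quotientVertex b S y)) ∧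
      (A ∉ S → hM.quotientVertex b S x = hM.quotientVertex b S y) := by
  classical
  obtain ⟨A, hA⟩ := hM.exists_unique_separating b hxy
  refine ⟨A, fun S => ⟨fun hAS => ?_, fun hAS => ?_⟩⟩
  · rw [hypercube_adj_iff, Finset.card_eq_one]
    refine ⟨A, Finset.ext fun B => ?_⟩
    rw [Finset.mem_symmDiff, mem_quotientVertex, mem_quotientVertex, Finset.mem_singleton, ← hA]
    constructor
    · tauto
    · intro h
      have := (hA B).1 h
      subst this
      tauto
  · ext B
    rw [mem_quotientVertex, mem_quotientVertex]
    have : B ∈ S → (x ∈ B.1 ↔ y ∈ B.1) := by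
      intro hB
      by_contra h
      rw [hA] at h
      subst h
      exact hAS hB
    tauto

theorem of_symmDiff_quotientVertex [DecidableEq (HalfspaceAvoiding G b)] (hM : IsLocallyMedian G)
    {S : Set (HalfspaceAvoiding G b)} {x y : V} {A : HalfspaceAvoiding G b}
    (h : hM.quotientVertex b S x ∆ hM.quotientVertex b S y = {A})
    (hA : A ∈ hM.quotientVertex b S y) :
    A ∈ S ∧ y ∈ A.1 ∧ x ∉ A.1 ∧ ∀ C ∈ S, C ≠ A → (x ∈ C.1 ↔ y ∈ C.1) := by
  have mem : ∀ C, (C ∈ hM.quotientVertex b S x ∧ C ∉ hM.quotientVertex b S y ∨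
      C ∈ hM.quotientVertex b S y ∧ C ∉ hM.quotientVertex b S x) ↔ C = A := by
    intro C
    rw [← Finset.mem_symmDiff, h, Finset.mem_singleton]
  obtain ⟨hyA, hAS⟩ := hM.mem_quotientVertex.1 hA
  refine ⟨hAS, hyA, fun hxA => ?_, fun C hC hCA => ?_⟩
  · have hx := hM.mem_quotientVertex.2 ⟨hxA, hAS⟩
    rcases (mem A).2 rfl with h' | h'
    · exact h'.2 hA
    · exact h'.2 hx
  · have := (mem C).not.2 hCA
    simp only [mem_quotientVertex, hC, and_true] at this
    tauto

/-- Each edge of the quotient switches one halfspace of `S`. Two different edges switching the same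
`A` would differ in some `B` crossing `A`; hence the edge is the only passage into `A`, that is, a
bridge. -/
theorem isTree_quotientGraph (hM : IsLocallyMedian G) {S : Set (HalfspaceAvoiding G b)}
    (hS : ∀ A ∈ S, ∀ B ∈ S, ¬ Crosses A.1 B.1) : (hM.quotientGraph b S).IsTree := by
  classical
  have hreach : ∀ u v, (hM.quotientGraph b S).Reachable ⟨_, u, rfl⟩ ⟨_, v, rfl⟩ := by
    intro u v
    obtain ⟨p⟩ := hM.connected u v
    induction p with
    | nil => rfl
    | @cons x y z h p ih =>
      obtain ⟨A, hA⟩ := hM.quotientVertex_of_adj (b := b) h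
      by_cases hAS : A ∈ S
      · have : (hM.quotientGraph b S).Adj ⟨_, x, rfl⟩ ⟨_, y, rfl⟩ := (hA S).1 hAS
        exact this.reachable.trans ih
      · have : (⟨_, x, rfl⟩ : Set.range (hM.quotientVertex b S)) = ⟨_, y, rfl⟩ :=
          Subtype.ext ((hA S).2 hAS)
        rw [this]
        exact ih
  have : Nonempty (Set.range (hM.quotientVertex b S)) := ⟨⟨_, b, rfl⟩⟩
  refine ⟨⟨?_⟩, ?_⟩
  · rintro ⟨_, u, rfl⟩ ⟨_, v, rfl⟩
    exact hreach u v
  -- an edge is determined by the halfspace in which its ends differ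
  have key : ∀ (s t p q : Set.range (hM.quotientVertex b S)) (A : HalfspaceAvoiding G b),
      s.1 ∆ t.1 = {A} → A ∈ t.1 → p.1 ∆ q.1 = {A} → A ∈ q.1 → p.1 ⊆ s.1 := by
    rintro ⟨_, x, rfl⟩ ⟨_, y, rfl⟩ ⟨_, u, rfl⟩ ⟨_, v, rfl⟩ A hst hAt hpq hAq B hB
    obtain ⟨hAS, hyA, hxA, hxy⟩ := hM.of_symmDiff_quotientVertex hst hAt
    obtain ⟨-, hvA, huA, huv⟩ := hM.of_symmDiff_quotientVertex hpq hAq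
    obtain ⟨huB, hBS⟩ := hM.mem_quotientVertex.1 hB
    refine hM.mem_quotientVertex.2 ⟨?_, hBS⟩
    by_contra hxB
    have hBA : B ≠ A := by
      rintro rfl
      exact huA huB
    exact hS A hAS B hBS ⟨⟨v, hvA, (huv B hBS hBA).1 huB⟩,
      ⟨y, hyA, fun h => hxB ((hxy B hBS hBA).2 h)⟩, ⟨u, huA, huB⟩, ⟨x, hxA, hxB⟩⟩
  have key' : ∀ (s t p q : Set.range (hM.quotientVertex b S)) (A : HalfspaceAvoiding G b),
      s.1 ∆ t.1 = {A} → A ∈ t.1 → p.1 ∆ q.1 = {A} → A ∈ q.1 → p = s ∧ q = t := by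
    intro s t p q A h1 h2 h3 h4
    have : p.1 = s.1 := (key s t p q A h1 h2 h3 h4).antisymm (key p q s t A h3 h4 h1 h2)
    refine ⟨Subtype.ext this, Subtype.ext ?_⟩
    rw [this, ← h1] at h3
    exact symmDiff_right_injective _ h3
  have bridge : ∀ (s t : Set.range (hM.quotientVertex b S)) (A : HalfspaceAvoiding G b),
      s.1 ∆ t.1 = {A} → A ∈ t.1 → A ∉ s.1 →
      ¬ ((hM.quotientGraph b S).deleteEdges {s(s, t)}).Reachable s t := by
    rintro s t A hst hAt hAs ⟨p⟩
    have : ∀ x y (p : ((hM.quotientGraph b S).deleteEdges {s(s, t)}).Walk x y),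
        A ∉ x.1 → A ∉ y.1 := by
      intro x y p
      induction p with
      | nil => exact id
      | @cons x z y h p ih =>
        intro hAx
        refine ih fun hAz => ?_
        rw [deleteEdges_adj] at h
        obtain ⟨B, hB⟩ := Finset.card_eq_one.1 (hypercube_adj_iff.1 h.1)
        have hAB : A = B := by
          rw [← Finset.mem_singleton, ← hB, Finset.mem_symmDiff]
          tauto
        subst hAB
        obtain ⟨rfl, rfl⟩ := key' s t x z A hst hAt hB hAz
        exact h.2 rfl
    exact this s t p hAs hAt
  rw [isAcyclic_iff_forall_adj_isBridge]
  intro s t hst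
  rw [isBridge_iff]
  obtain ⟨A, hA⟩ := Finset.card_eq_one.1 (hypercube_adj_iff.1 hst)
  have hmem : A ∈ s.1 ∆ t.1 := by rw [hA, Finset.mem_singleton]
  rcases Finset.mem_symmDiff.1 hmem with ⟨h1, h2⟩ | ⟨h1, h2⟩
  · rw [reachable_comm, Sym2.eq_swap]
    exact bridge t s A (by rw [symmDiff_comm, hA]) h1 h2
  · exact bridge s t A hA h1 h2

/-- If no two halfspaces of the same colour cross, then the graph is an isometric subgraph of
the product of two trees. -/
theorem isPartialDoubleTree (hM : IsLocallyMedian G) (b : V) (S : Set (HalfspaceAvoiding G b))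
    (hS : ∀ A ∈ S, ∀ B ∈ S, ¬ Crosses A.1 B.1) (hS' : ∀ A ∉ S, ∀ B ∉ S, ¬ Crosses A.1 B.1) :
    IsPartialDoubleTree G := by
  classical
  refine ⟨_, _, hM.quotientGraph b S, hM.quotientGraph b Sᶜ, hM.isTree_quotientGraph hS,
    hM.isTree_quotientGraph hS', fun v => (⟨_, v, rfl⟩, ⟨_, v, rfl⟩), ?_⟩
  refine isIsometric_of_dist_le hM.connected (fun x y hxy => ?_) (fun x y => ?_)
  · obtain ⟨A, hA⟩ := hM.quotientVertex_of_adj (b := b) hxy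
    rw [boxProd_adj]
    by_cases hAS : A ∈ S
    · exact Or.inl ⟨(hA S).1 hAS, Subtype.ext ((hA Sᶜ).2 (by simpa using hAS))⟩
    · exact Or.inr ⟨(hA Sᶜ).1 hAS, Subtype.ext ((hA S).2 hAS)⟩
  · rw [edist_boxProd]
    have le : ∀ S, ((hM.quotientVertex b S x ∆ hM.quotientVertex b S y).card : ℕ∞) ≤
        (hM.quotientGraph b S).edist ⟨_, x, rfl⟩ ⟨_, y, rfl⟩ := fun S =>
      (card_symmDiff_le_edist _ _).trans
        (edist_map_le (G := hM.quotientGraph b S) Subtype.val (fun _ _ h => h) _ _)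
    -- Every halfspace separating `x` from `y` is counted in one of the two factors.
    refine le_trans ?_ (add_le_add (le S) (le Sᶜ))
    rw [← Nat.cast_add, Nat.cast_le]
    refine (hM.dist_le_card_symmDiff (b := b) x y).trans
      (le_trans (Finset.card_le_card ?_) (Finset.card_union_le _ _))
    intro A hA
    rw [Finset.mem_symmDiff, mem_cubeVertex, mem_cubeVertex] at hA
    rw [Finset.mem_union, Finset.mem_symmDiff, Finset.mem_symmDiff, mem_quotientVertex,
      mem_quotientVertex, mem_quotientVertex, mem_quotientVertex, Set.mem_compl_iff]
    tauto

end IsLocallyMedian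

/-- A median graph with a bipartite incompatibility graph is a partial double tree. -/
theorem IsMedian.isPartialDoubleTree_of_incGraph (h : IsMedian G)
    (hInc : (incGraph G).IsBipartite) : IsPartialDoubleTree G := by
  classical
  have hM := h.isLocallyMedian
  obtain ⟨c⟩ := hInc
  let b := hM.connected.nonempty.some
  have split : ∀ A : HalfspaceAvoiding G b, A.1.Nonempty → IsConvexSplit G {A.1, A.1ᶜ} :=
    fun A hA => ⟨A.1, rfl, hA, ⟨b, A.2.2⟩, A.2.1.1, A.2.1.2⟩
  -- The empty halfspace belongs to no split; its colour is arbitrary, since it crosses nothing.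
  let col : HalfspaceAvoiding G b → Fin 2 :=
    fun A => if hA : A.1.Nonempty then c ⟨_, split A hA⟩ else 0
  have key : ∀ A B : HalfspaceAvoiding G b, Crosses A.1 B.1 → col A ≠ col B := by
    rintro A B ⟨h1, h2, h3, h4⟩
    have hA : A.1.Nonempty := h1.mono Set.inter_subset_left
    have hB : B.1.Nonempty := h1.mono Set.inter_subset_right
    simp only [col, hA, hB, dif_pos]
    apply c.valid
    rintro P (rfl | rfl) Q (rfl | rfl) <;> assumption
  refine hM.isPartialDoubleTree b {A | col A = 0} (fun A hA B hB h => key A B h ?_)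
    (fun A hA B hB h => key A B h ?_)
  · have hA : col A = 0 := hA
    have hB : col B = 0 := hB
    rw [hA, hB]
  · have hA : col A ≠ 0 := hA
    have hB : col B ≠ 0 := hB
    omega

end Trees

/-! ### Medians from forbidden isometric subgraphs. -/

section IsometricCycles

variable {V : Type u} {G : SimpleGraph V}

theorem dist_eq_sub_of_steps (hG : G.Connected) {g : ℕ → V} {N : ℕ}
    (hg : ∀ k < N, G.Adj (g k) (g (k + 1))) (hd : G.dist (g 0) (g N) = N) {i j : ℕ} (hij : i ≤ j)
    (hj : j ≤ N) : G.dist (g i) (g j) = j - i := by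
  obtain ⟨p₁, h₁⟩ := exists_walk_of_steps hg (Nat.zero_le i) (hij.trans hj)
  obtain ⟨p₂, h₂⟩ := exists_walk_of_steps hg hij hj
  obtain ⟨p₃, h₃⟩ := exists_walk_of_steps hg hj le_rfl
  have d₁ := dist_le p₁
  have d₂ := dist_le p₂
  have d₃ := dist_le p₃
  have t₁ := hG.dist_triangle (u := g 0) (v := g i) (w := g N)
  have t₂ := hG.dist_triangle (u := g i) (v := g j) (w := g N)
  omega

theorem exists_geodesic_through (hG : G.Connected) {b x y : V} {n : ℕ} (hyx : G.Adj y x)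
    (hy : G.dist b y = n) :
    ∃ g : ℕ → V, g 0 = b ∧ g n = y ∧ g (n + 1) = x ∧ ∀ k < n + 1, G.Adj (g k) (g (k + 1)) := by
  obtain ⟨p, hp⟩ := hG.exists_walk_length_eq_dist b y
  refine ⟨fun k => if k ≤ n then p.getVert k else x, ?_, ?_, ?_, ?_⟩
  · simp
  · simp only [le_refl, if_true]
    rw [← hy, ← hp, Walk.getVert_length]
  · simp
  · intro k hk
    by_cases hkn : k = n
    · subst hkn
      simp only [le_refl, if_true, show ¬ k + 1 ≤ k by omega, if_false]
      rw [← hy, ← hp, Walk.getVert_length]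
      exact hyx
    · simp only [show k ≤ n by omega, show k + 1 ≤ n by omega, if_true]
      exact p.adj_getVert_succ (by omega)

/-- At the lowest failing level `n + 1`, two geodesics from `b` to `x`, through `y₁` and through
`y₂`, close up to an isometric cycle of length `2 * n + 2`. The induction runs over all base
vertices at once, because the base has to be changed. -/
theorem quadrangleUpTo_of_no_isometric_cycle (hG : G.Connected) (hb : NoEquidistantEdge G)
    (hcyc : ∀ k, 2 ≤ k → ¬ IsIsometricSubgraph (cycleGraph (2 * k + 2)) G) (n : ℕ) :
    ∀ b, QuadrangleUpTo G b n := by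
  induction n with
  | zero =>
    intro b x y₁ y₂ hx _ _ _ h
    omega
  | succ n ih =>
    intro b x y₁ y₂ hx hxy₁ hxy₂ hne h₁ h₂
    by_cases hxn : G.dist b x ≤ n
    · exact ih b x y₁ y₂ hxn hxy₁ hxy₂ hne h₁ h₂
    have hx : G.dist b x = n + 1 := by omega
    have hy₁ : G.dist b y₁ = n := by omega
    have hy₂ : G.dist b y₂ = n := by omega
    by_contra hno
    have hn : 2 ≤ n := by
      by_contra hn
      obtain rfl | rfl : n = 0 ∨ n = 1 := by omega
      · exact hne ((hG.dist_eq_zero_iff.1 hy₁).symm.trans (hG.dist_eq_zero_iff.1 hy₂))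
      · refine hno ⟨b, (dist_eq_one_iff_adj.1 hy₁).symm, (dist_eq_one_iff_adj.1 hy₂).symm, ?_⟩
        rw [hx, G.dist_self]
    -- Otherwise `x` has a lower level over `c`, where the quadrangle condition already holds.
    have hdisj : ∀ c, G.dist b y₁ = G.dist b c + G.dist c y₁ →
        G.dist b y₂ = G.dist b c + G.dist c y₂ → c = b := by
      intro c hc₁ hc₂
      by_contra hcb
      have hpos := hG.pos_dist_of_ne (Ne.symm hcb)
      have t₁ := dist_le_succ_of_adj hG hxy₁ c
      have t₂ := hG.dist_triangle (u := b) (v := c) (w := x)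
      obtain ⟨z, hz₁, hz₂, hz⟩ := ih c x y₁ y₂ (by omega) hxy₁ hxy₂ hne (by omega) (by omega)
      have t₃ := hG.dist_triangle (u := b) (v := c) (w := z)
      have t₄ := dist_le_succ_of_adj hG hz₁ b
      exact hno ⟨z, hz₁, hz₂, by omega⟩
    obtain ⟨p, p0, pn, px, hp⟩ := exists_geodesic_through hG hxy₁.symm hy₁
    obtain ⟨q, q0, qn, qx, hq⟩ := exists_geodesic_through hG hxy₂.symm hy₂
    have dp := fun i j => dist_eq_sub_of_steps hG hp (i := i) (j := j) (by rw [p0, px, hx])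
    have dq := fun i j => dist_eq_sub_of_steps hG hq (i := i) (j := j) (by rw [q0, qx, hx])
    let f : ℕ → V := fun k => if k ≤ n + 1 then p k else q (2 * n + 2 - k)
    have f₁ : ∀ k ≤ n + 1, f k = p k := fun k hk => by simp [f, hk]
    have f₂ : ∀ k, n + 1 ≤ k → f k = q (2 * n + 2 - k) := by
      intro k hk
      by_cases h : k = n + 1
      · rw [f₁ k (by omega), h, px, show 2 * n + 2 - (n + 1) = n + 1 by omega, qx]
      · simp [f, show ¬ k ≤ n + 1 by omega]
    have hsteps : ∀ k < 2 * n + 2, G.Adj (f k) (f (k + 1)) := by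
      intro k hk
      by_cases h : k < n + 1
      · rw [f₁ k h.le, f₁ (k + 1) h]
        exact hp k h
      · rw [f₂ k (by omega), f₂ (k + 1) (by omega),
          show 2 * n + 2 - k = 2 * n + 2 - (k + 1) + 1 by omega]
        exact (hq _ (by omega)).symm
    refine hcyc n hn ⟨_, isIsometric_cycleGraph (L := 2 * n + 2) (by omega) hsteps ?_ ?_⟩
    · rw [f₂ _ (by omega), f₁ 0 (by omega), Nat.sub_self, q0, p0]
    intro i j hij hj
    rw [← (hG _ _).coe_dist_eq_edist, Nat.cast_le]
    by_cases hj' : j ≤ n + 1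
    · rw [f₁ i (by omega), f₁ j hj', dp i j hij.le hj']
      exact min_le_left _ _
    by_cases hi' : n + 1 ≤ i
    · rw [f₂ i hi', f₂ j (by omega), G.dist_comm, dq _ _ (by omega) (by omega)]
      refine (min_le_left _ _).trans ?_
      omega
    rw [f₁ i (by omega), f₂ j (by omega)]
    obtain ⟨j', hj'e⟩ : ∃ j', 2 * n + 2 - j = j' := ⟨_, rfl⟩
    rw [hj'e]
    by_contra hlt
    have ep := dp 0 i (by omega) (by omega)
    have eq := dq 0 j' (by omega) (by omega)
    have ep' := dp i n (by omega) (by omega)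
    have eq' := dq j' n (by omega) (by omega)
    rw [p0] at ep
    rw [q0] at eq
    rw [pn] at ep'
    rw [qn] at eq'
    -- A connection shorter than both arcs of the cycle stays at levels at most `n`, so `b`, `p i`,
    -- `q j'` have a median. It lies on geodesics from `b` to both `y₁` and `y₂`, hence equals `b`,
    -- and the connection is no shorter than the arc through `b`.
    obtain ⟨m, hm, m₁, m₂⟩ := exists_median_of_quadrangleUpTo hG hb (ih b) (p i) (q j') (by
      intro r hr
      have hr : G.dist (p i) (q j') = G.dist (p i) r + G.dist r (q j') := hr
      have t₁ := hG.dist_triangle (u := b) (v := p i) (w := r)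
      have t₂ := hG.dist_triangle (u := b) (v := q j') (w := r)
      rw [G.dist_comm (u := q j') (v := r)] at t₂
      omega)
    have hm : G.dist (p i) (q j') = G.dist (p i) m + G.dist m (q j') := hm
    have t₁ := hG.dist_triangle (u := m) (v := p i) (w := y₁)
    have t₂ := hG.dist_triangle (u := m) (v := q j') (w := y₂)
    have t₃ := hG.dist_triangle (u := b) (v := m) (w := y₁)
    have t₄ := hG.dist_triangle (u := b) (v := m) (w := y₂)
    rw [G.dist_comm (u := m) (v := p i)] at t₁
    rw [G.dist_comm (u := m) (v := q j')] at t₂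
    have hmb := hdisj m (by omega) (by omega)
    subst hmb
    rw [G.dist_self] at m₁ m₂
    rw [G.dist_comm (u := m) (v := q j')] at hm
    omega

theorem noEquidistantEdge_of_isBipartite (hG : G.Connected) (h : G.IsBipartite) :
    NoEquidistantEdge G := by
  intro z u v huv hd
  obtain ⟨p, hp⟩ := hG.exists_walk_length_eq_dist z u
  obtain ⟨q, hq⟩ := hG.exists_walk_length_eq_dist z v
  have := two_colorable_iff_forall_loop_even.1 h z ((p.concat huv).append q.reverse)
  rw [Walk.length_append, Walk.length_concat, Walk.length_reverse, hp, hq, hd, Nat.even_iff] at this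
  omega

theorem isIsometric_of_edist_le_two {W : Type v} {H : SimpleGraph W} {f : W → V}
    (hinj : Function.Injective f) (hadj : ∀ x y, G.Adj (f x) (f y) ↔ H.Adj x y)
    (h2 : ∀ x y, H.edist x y ≤ 2) : IsIsometric H G f := by
  intro x y
  refine le_antisymm (edist_map_le f (fun x y => (hadj x y).2) x y) ?_
  by_cases hxy : x = y
  · subst hxy; simp
  by_cases ha : H.Adj x y
  · rw [edist_eq_one_iff_adj.2 ha, edist_eq_one_iff_adj.2 ((hadj x y).2 ha)]
  · refine (h2 x y).trans ?_
    have : ¬ G.edist (f x) (f y) ≤ 1 := by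
      rw [edist_le_one_iff_adj_or_eq, hadj]
      rintro (h | h)
      · exact ha h
      · exact hxy (hinj h)
    exact Order.add_one_le_of_lt (not_le.1 this)

theorem isIsometricSubgraph_K23 (hb : NoEquidistantEdge G) {x v a b c : V} (hxv : x ≠ v)
    (hab : a ≠ b) (hbc : b ≠ c) (hac : a ≠ c) (xa : G.Adj x a) (xb : G.Adj x b) (xc : G.Adj x c)
    (va : G.Adj v a) (vb : G.Adj v b) (vc : G.Adj v c) : IsIsometricSubgraph K23 G := by
  refine ⟨Sum.elim ![x, v] ![a, b, c], isIsometric_of_edist_le_two ?_ ?_ ?_⟩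
  · have := xa.ne; have := xb.ne; have := xc.ne; have := va.ne; have := vb.ne; have := vc.ne
    rintro (i | i) (j | j) h <;> fin_cases i <;> fin_cases j <;> simp_all
  · have h1 := hb.not_adj xa.symm va.symm
    have h2 := hb.not_adj xa xb
    have h3 := hb.not_adj xa xc
    have h4 := hb.not_adj xb xc
    have h1' := hb.not_adj va.symm xa.symm
    have h2' := hb.not_adj xb xa
    have h3' := hb.not_adj xc xa
    have h4' := hb.not_adj xc xb
    rintro (i | i) (j | j) <;> fin_cases i <;> fin_cases j <;>
      simp [K23, xa, xb, xc, va, vb, vc, h1, h2, h3, h4, h1', h2', h3', h4', xa.symm, xb.symm,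
        xc.symm, va.symm, vb.symm, vc.symm]
  · have key : ∀ s t w : Fin 2 ⊕ Fin 3, K23.Adj s w → K23.Adj w t → K23.edist s t ≤ 2 := by
      intro s t w h1 h2
      have := edist_le (Walk.cons h1 (Walk.cons h2 Walk.nil))
      simpa using this
    have one : ∀ s t : Fin 2 ⊕ Fin 3, K23.Adj s t → K23.edist s t ≤ 2 := by
      intro s t h
      rw [edist_eq_one_iff_adj.2 h]
      exact one_le_two
    rintro (i | i) (j | j)
    · exact key _ _ (Sum.inr 0) (by simp [K23]) (by simp [K23])
    · exact one _ _ (by simp [K23])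
    · exact one _ _ (by simp [K23])
    · exact key _ _ (Sum.inl 0) (by simp [K23]) (by simp [K23])

/-- A connected graph without isometric `K_{2,3}` all of whose isometric cycles are squares is
a median graph. -/
theorem isLocallyMedian_of_no_isometric_cycle (hG : G.Connected)
    (h3 : ¬ IsIsometricSubgraph (cycleGraph 3) G) (hK : ¬ IsIsometricSubgraph K23 G)
    (hcyc : ∀ k, 2 ≤ k → ¬ IsIsometricSubgraph (cycleGraph (k + 3)) G) : IsLocallyMedian G := by
  have hbip : NoEquidistantEdge G := by
    refine noEquidistantEdge_of_isBipartite hG ?_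
    by_contra h
    obtain ⟨k, hk, hiso⟩ := exists_isometric_odd_cycle h
    by_cases hk1 : k = 1
    · subst hk1; exact h3 hiso
    · refine hcyc (2 * k - 2) (by omega) ?_
      rwa [show 2 * k - 2 + 3 = 2 * k + 1 by omega]
  refine ⟨hG, hbip, fun b n =>
    quadrangleUpTo_of_no_isometric_cycle hG hbip (fun k hk h => ?_) n b, ?_⟩
  · refine hcyc (2 * k - 1) (by omega) ?_
    rwa [show 2 * k - 1 + 3 = 2 * k + 2 by omega]
  · intro x v a b c h1 h2 h3 h4 h5 h6 h7 h8 h9 h10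
    exact hK (isIsometricSubgraph_K23 hbip h1 h2 h3 h4 h5 h6 h7 h8 h9 h10)

end IsometricCycles

/-! ### From colourings of the link graph to colourings of splits. -/

section LinkToSplits

variable {V : Type u} {G : SimpleGraph V}

theorem IsInducedC4.linkGraph_adj {x y z w : V} (h : IsInducedC4 G x y z w) :
    (linkGraph G).Adj ⟨s(x, y), h.1⟩ ⟨s(x, w), h.2.2.2.1.symm⟩ :=
  ⟨x, ⟨h.1, Sym2.mem_mk_left _ _⟩, ⟨h.2.2.2.1.symm, Sym2.mem_mk_left _ _⟩, y, z, w, h, rfl, rfl⟩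

namespace IsLocallyMedian

theorem isInducedC4 (hM : IsLocallyMedian G) {e f : V × V} (h : OppositeSides G e f) :
    IsInducedC4 G e.1 e.2 f.2 f.1 :=
  ⟨h.1, h.2.2.2.1, h.2.1.symm, h.2.2.1.symm, h.2.2.2.2.1, h.2.2.2.2.2,
    hM.not_adj_of_common h.1.symm h.2.2.2.1, hM.not_adj_of_common h.1 h.2.2.1⟩

/-- Both sides are coloured differently from a third side adjacent to them, and there are only two
colours. -/
theorem coloring_eq_of_oppositeSides (hM : IsLocallyMedian G)
    (c : (linkGraph G).Coloring (Fin 2)) {e f : V × V} (h : OppositeSides G e f) :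
    c ⟨s(e.1, e.2), h.1⟩ = c ⟨s(f.1, f.2), h.2.1⟩ := by
  obtain ⟨x, y⟩ := e
  obtain ⟨u, v⟩ := f
  have h1 := c.valid (hM.isInducedC4 h).linkGraph_adj
  have h2 := c.valid (hM.isInducedC4 h.symm).linkGraph_adj
  simp only at h1 h2 ⊢
  have h3 : (⟨s(u, x), h.2.2.1.symm⟩ : {e : Sym2 V // e ∈ G.edgeSet}) = ⟨s(x, u), h.2.2.1⟩ :=
    Subtype.ext Sym2.eq_swap
  rw [h3] at h2
  omega

theorem coloring_eq_of_crossing (hM : IsLocallyMedian G) (c : (linkGraph G).Coloring (Fin 2))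
    {A : Set V} (hA : IsHalfspace G A) {x y u v : V} (hxy : G.Adj x y) (huv : G.Adj u v)
    (hx : x ∈ A) (hy : y ∉ A) (hu : u ∈ A) (hv : v ∉ A) :
    c ⟨s(x, y), hxy⟩ = c ⟨s(u, v), huv⟩ := by
  have e := hM.eq_nearer_of_isHalfspace hxy hA hx hy
  rw [e] at hu hv
  have : ∀ f : V × V, Relation.ReflTransGen (OppositeSides G) (x, y) f →
      ∀ hf : G.Adj f.1 f.2, c ⟨s(x, y), hxy⟩ = c ⟨s(f.1, f.2), hf⟩ := by
    intro f hf
    induction hf with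
    | refl => intro _; rfl
    | tail _ h ih => intro _; rw [ih h.1, hM.coloring_eq_of_oppositeSides c h]
  exact this (u, v) (hM.exists_ladder hxy huv hu hv) huv

/-- Two crossing halfspaces cross in a square. -/
theorem exists_square_of_crosses (hM : IsLocallyMedian G) {A C : Set V} (hA : IsHalfspace G A)
    (hC : IsHalfspace G C) (h : Crosses A C) :
    ∃ e f : V × V, OppositeSides G e f ∧ e.1 ∈ A ∧ e.2 ∉ A ∧ e.1 ∈ C ∧ f.1 ∉ C := by
  obtain ⟨⟨x, hxA, hxC⟩, ⟨u, huA, huC⟩, ⟨y, hyA, hyC⟩, ⟨v, hvA, hvC⟩⟩ := h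
  have edge : ∀ D : Set V, IsConvex G D → ∀ x y, x ∈ A → y ∉ A → x ∈ D → y ∈ D →
      ∃ p p', G.Adj p p' ∧ p ∈ A ∧ p' ∉ A ∧ p ∈ D := by
    intro D hD x y hx hy hxD hyD
    obtain ⟨p, p', hpp, hp, hp', hd⟩ := exists_adj_mem_notMem hM.connected hx hy
    refine ⟨p, p', hpp, hp, hp', hD x hxD y hyD (mem_interval_of_le hM.connected ?_)⟩
    have h1 : G.dist p p' = 1 := dist_eq_one_iff_adj.2 hpp
    have h2 := hM.connected.dist_triangle (u := p) (v := p') (w := y)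
    omega
  obtain ⟨p, p', hpp, hpA, hp'A, hpC⟩ := edge C hC.1 x y hxA hyA hxC hyC
  obtain ⟨q, q', hqq, hqA, hq'A, hqC⟩ := edge Cᶜ hC.2 u v huA hvA huC hvC
  have e := hM.eq_nearer_of_isHalfspace hpp hA hpA hp'A
  -- Follow a ladder from an edge cut by `A` that starts in `C` to one that starts in `Cᶜ`: where
  -- its rail leaves `C`, the two consecutive rungs form the square.
  have key : ∀ f : V × V, Relation.ReflTransGen (OppositeSides G) (p, p') f →
      (A = nearer G f.1 f.2) ∧ (f.1 ∉ C → ∃ e f : V × V, OppositeSides G e f ∧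
        e.1 ∈ A ∧ e.2 ∉ A ∧ e.1 ∈ C ∧ f.1 ∉ C) := by
    intro f hf
    induction hf with
    | refl => exact ⟨e, fun h => absurd hpC h⟩
    | @tail g g' _ h ih =>
      refine ⟨ih.1.trans (hM.nearer_eq_of_oppositeSides h), fun hg' => ?_⟩
      by_cases hg : g.1 ∈ C
      · obtain ⟨h1, h2⟩ := mem_nearer h.1
        rw [← ih.1] at h1 h2
        exact ⟨g, g', h, h1, h2, hg, hg'⟩
      · exact ih.2 hg
  rw [e] at hqA hq'A
  exact (key (q, q') (hM.exists_ladder hpp hqq hqA hq'A)).2 hqC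

/-- A split receives the common colour of the edges it cuts; a square in which two splits cross has
adjacent sides cut by each of them. -/
theorem incGraph_isBipartite (hM : IsLocallyMedian G) (hL : (linkGraph G).IsBipartite) :
    (incGraph G).IsBipartite := by
  obtain ⟨c⟩ := hL
  have hsplit : ∀ σ : {σ : Set (Set V) // IsConvexSplit G σ}, ∀ A ∈ σ.1, IsHalfspace G A := by
    rintro ⟨_, B, rfl, -, -, h1, h2⟩ A (rfl | rfl)
    · exact ⟨h1, h2⟩
    · exact IsHalfspace.compl ⟨h1, h2⟩
  have hcol : ∀ σ : {σ : Set (Set V) // IsConvexSplit G σ}, ∃ k : Fin 2, ∀ A ∈ σ.1, ∀ x y,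
      ∀ h : G.Adj x y, x ∈ A → y ∉ A → c ⟨s(x, y), h⟩ = k := by
    rintro ⟨_, B, rfl, ⟨x, hx⟩, ⟨y, hy⟩, h1, h2⟩
    obtain ⟨p, p', hpp, hp, hp', -⟩ := exists_adj_mem_notMem hM.connected hx hy
    refine ⟨c ⟨s(p, p'), hpp⟩, ?_⟩
    rintro A (rfl | rfl) u v huv hu hv
    · exact hM.coloring_eq_of_crossing c ⟨h1, h2⟩ huv hpp hu hv hp hp'
    · have h3 : (⟨s(u, v), huv⟩ : {e : Sym2 V // e ∈ G.edgeSet}) = ⟨s(v, u), huv.symm⟩ :=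
        Subtype.ext Sym2.eq_swap
      rw [h3]
      exact hM.coloring_eq_of_crossing c ⟨h1, h2⟩ huv.symm hpp (not_not.1 hv) hu hp hp'
  choose k hk using hcol
  refine ⟨Coloring.mk k ?_⟩
  intro σ τ hadj hkk
  obtain ⟨A, hA, -⟩ := id σ.2
  obtain ⟨C, hC, -⟩ := id τ.2
  have hA1 : A ∈ σ.1 := by rw [hA]; simp
  have hA2 : Aᶜ ∈ σ.1 := by rw [hA]; simp
  have hC1 : C ∈ τ.1 := by rw [hC]; simp
  have hC2 : Cᶜ ∈ τ.1 := by rw [hC]; simp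
  obtain ⟨e, f, hef, h1, h2, h3, h4⟩ := hM.exists_square_of_crosses (hsplit σ A hA1)
    (hsplit τ C hC1) ⟨hadj A hA1 C hC1, hadj A hA1 _ hC2, hadj _ hA2 C hC1, hadj _ hA2 _ hC2⟩
  refine c.valid (hM.isInducedC4 hef).linkGraph_adj ?_
  rw [hk σ A hA1 _ _ _ h1 h2, hk τ C hC1 _ _ _ h3 h4, hkk]

end IsLocallyMedian

end LinkToSplits

/-! ### Gluing colourings of the vertex links. -/

section Coboundary

variable {V : Type u} {G : SimpleGraph V}

namespace IsLocallyMedian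

/-- A symmetric function on the edges whose sum over every square is zero is a coboundary. -/
theorem exists_potential (hM : IsLocallyMedian G) (ω : V → V → ZMod 2)
    (hsymm : ∀ x y, ω x y = ω y x)
    (hsq : ∀ x y₁ y₂ z, G.Adj x y₁ → G.Adj x y₂ → G.Adj y₁ z → G.Adj y₂ z → y₁ ≠ y₂ → x ≠ z →
      ω z y₁ + ω y₁ x = ω z y₂ + ω y₂ x) :
    ∃ s : V → ZMod 2, ∀ x y, G.Adj x y → s x = s y + ω y x := by
  obtain ⟨b⟩ := hM.connected.nonempty
  have hpar : ∀ x, ∃ y, x ≠ b → G.Adj x y ∧ G.dist b x = G.dist b y + 1 := by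
    intro x
    by_cases h : x = b
    · exact ⟨x, fun h' => absurd h h'⟩
    · obtain ⟨y, hy, hd⟩ := exists_adj_dist_eq_succ hM.connected h
      exact ⟨y, fun _ => ⟨hy, by rw [G.dist_comm, hd, G.dist_comm]⟩⟩
  choose par hpar using hpar
  -- Sum `ω` along parents towards `b`. The value `S n x` is used only for `n = G.dist b x`; a
  -- separate level index makes the recursion structural.
  let S : ℕ → V → ZMod 2 := fun n => Nat.rec (fun _ => 0) (fun _ T x => T (par x) + ω (par x) x) n
  have hS : ∀ n x, S (n + 1) x = S n (par x) + ω (par x) x := fun _ _ => rfl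
  have key : ∀ n x y, G.dist b x = n + 1 → G.dist b y = n → G.Adj x y →
      S (n + 1) x = S n y + ω y x := by
    intro n
    induction n with
    | zero =>
      intro x y hx hy hxy
      have hxb : x ≠ b := by rintro rfl; rw [G.dist_self] at hx; omega
      have h1 := hM.connected.dist_eq_zero_iff.1 hy
      have h2 : b = par x := hM.connected.dist_eq_zero_iff.1 (by have := (hpar x hxb).2; omega)
      rw [hS, ← h2, h1]
    | succ n ih =>
      intro x y hx hy hxy
      have hxb : x ≠ b := by rintro rfl; rw [G.dist_self] at hx; omega
      obtain ⟨hadj, hd⟩ := hpar x hxb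
      rw [hS (n + 1) x]
      by_cases hpy : par x = y
      · rw [hpy]
      obtain ⟨z, hz₁, hz₂, hz⟩ := hM.quad b _ x (par x) y le_rfl hadj hxy hpy hd (by omega)
      rw [ih (par x) z (by omega) (by omega) hz₁, ih y z hy (by omega) hz₂, add_assoc, add_assoc,
        hsq x (par x) y z hadj hxy hz₁ hz₂ hpy (by rintro rfl; omega)]
  refine ⟨fun x => S (G.dist b x) x, fun x y hxy => ?_⟩
  rcases hM.dist_cases hxy b with h | h
  · simp only [h]
    exact key _ x y h rfl hxy
  · simp only [h]
    rw [key _ y x h rfl hxy.symm, hsymm, add_assoc, CharTwo.add_self_eq_zero, add_zero]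

/-- The colours that an edge receives at its two ends may disagree. In a square the two sides at
each of the four corners differ by one, so the disagreements sum to zero; a potential for them says
at which vertices to swap the colours. -/
theorem linkGraph_isBipartite (hM : IsLocallyMedian G)
    (hL : ∀ x, (vertexLink G x).IsBipartite) : (linkGraph G).IsBipartite := by
  classical
  have c : ∀ x, (vertexLink G x).Coloring (ZMod 2) := fun x => (hL x).some
  let col : V → V → ZMod 2 := fun x y =>
    if h : G.Adj x y then c x ⟨s(x, y), h, Sym2.mem_mk_left _ _⟩ else 0
  have hcol : ∀ x y (h : G.Adj x y), col x y = c x ⟨s(x, y), h, Sym2.mem_mk_left _ _⟩ :=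
    fun x y h => by simp [col, h]
  have hne : ∀ x y z w, IsInducedC4 G x y z w → col x y ≠ col x w := by
    intro x y z w h
    rw [hcol x y h.1, hcol x w h.2.2.2.1.symm]
    exact (c x).valid ⟨y, z, w, h, rfl, rfl⟩
  have two : ∀ a b : ZMod 2, a ≠ b → a = b + 1 := by decide
  obtain ⟨s, hs⟩ := hM.exists_potential (fun x y => col x y + col y x)
    (fun x y => add_comm _ _) (by
      intro x y₁ y₂ z h₁ h₂ hz₁ hz₂ hne' hxz
      have hC : IsInducedC4 G x y₁ z y₂ :=
        ⟨h₁, hz₁, hz₂.symm, h₂.symm, hxz, hne', hM.not_adj_of_common h₁.symm hz₁,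
          hM.not_adj_of_common h₁ h₂⟩
      have hC₁ : IsInducedC4 G y₁ x y₂ z :=
        ⟨h₁.symm, h₂, hz₂, hz₁.symm, hne', hxz, hC.2.2.2.2.2.2.2, hC.2.2.2.2.2.2.1⟩
      have hC₂ : IsInducedC4 G z y₁ x y₂ :=
        ⟨hz₁.symm, h₁.symm, h₂, hz₂, hxz.symm, hne', fun h => hC.2.2.2.2.2.2.1 h.symm,
          hC.2.2.2.2.2.2.2⟩
      have hC₃ : IsInducedC4 G y₂ x y₁ z :=
        ⟨h₂.symm, h₁, hz₁, hz₂.symm, hne'.symm, hxz, fun h => hC.2.2.2.2.2.2.2 h.symm,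
          hC.2.2.2.2.2.2.1⟩
      have e := two _ _ (hne _ _ _ _ hC)
      have e₁ := two _ _ (hne _ _ _ _ hC₁)
      have e₂ := two _ _ (hne _ _ _ _ hC₂)
      have e₃ := two _ _ (hne _ _ _ _ hC₃)
      rw [e, e₁, e₂, e₃]
      have h2 : (2 : ZMod 2) = 0 := rfl
      linear_combination (col y₁ z - col y₂ z + 1) * h2)
  have hk : ∀ e : {e : Sym2 V // e ∈ G.edgeSet}, ∃ k : ZMod 2, ∀ x y, e.1 = s(x, y) →
      k = s x + col x y := by
    rintro ⟨e, he⟩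
    induction e using Sym2.ind with
    | _ x y =>
    have hxy : G.Adj x y := he
    refine ⟨s x + col x y, fun u v huv => ?_⟩
    rcases Sym2.eq_iff.1 huv with ⟨rfl, rfl⟩ | ⟨rfl, rfl⟩
    · rfl
    · rw [hs _ _ hxy]
      have h2 : (2 : ZMod 2) = 0 := rfl
      linear_combination (col x y) * h2
  choose k hk using hk
  have C : (linkGraph G).Coloring (ZMod 2) := Coloring.mk k (by
    rintro e f ⟨x, he, hf, y, z, w, h, hey, hfw⟩ hkk
    refine hne x y z w h ?_
    rw [hk e x y hey, hk f x w hfw] at hkk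
    exact add_left_cancel hkk)
  exact ⟨C⟩

end IsLocallyMedian

end Coboundary

/-! ### Forbidden subgraphs from odd cycles in links. -/

section OddLinks

variable {V : Type u} {G : SimpleGraph V}

namespace IsLocallyMedian

theorem isIsometricSubgraph_of_cubeVertex (hM : IsLocallyMedian G) {b : V} {n : ℕ}
    {a : Fin n → HalfspaceAvoiding G b} (ha : Function.Injective a) {P : Finset (Fin n) → Prop}
    {K : SimpleGraph {s // P s}} (hK : ∀ s t : {s // P s}, K.edist s t = (s.1 ∆ t.1).card)
    (hP : ∀ s, P s → ∃ v, ∀ A, A ∈ hM.cubeVertex b v ↔ ∃ i ∈ s, a i = A) :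
    IsIsometricSubgraph K G := by
  classical
  choose g hg using hP
  refine ⟨fun s => g s.1 s.2, fun s t => ?_⟩
  have himg : ∀ s : {s // P s}, hM.cubeVertex b (g s.1 s.2) = s.1.image a := by
    intro s
    ext A
    rw [hg, Finset.mem_image]
  rw [← hM.isIsometric_cubeVertex b, hypercube_edist, hK, himg, himg,
    ← Finset.image_symmDiff _ _ ha, Finset.card_image_of_injective _ ha]

/-- In cube coordinates based at `x`, the neighbours on an odd cycle of the link are singletons, and
the squares between consecutive ones supply the pairs. Leaving `P` and `K` open covers both `Q₃ - v`
and the cogwheels. -/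
theorem exists_of_not_isBipartite_vertexLink (hM : IsLocallyMedian G) {x : V}
    (h : ¬ (vertexLink G x).IsBipartite) :
    ∃ k, 1 ≤ k ∧ ∀ (P : Finset (Fin (2 * k + 1)) → Prop) (K : SimpleGraph {s // P s}),
      (∀ s t : {s // P s}, K.edist s t = (s.1 ∆ t.1).card) →
      (∀ s, P s → s.card ≤ 2 ∧ (cycleGraph (2 * k + 1)).IsClique s) → IsIsometricSubgraph K G := by
  classical
  obtain ⟨k, hk, f, hf⟩ := exists_isometric_odd_cycle h
  refine ⟨k, hk, fun P K hK hP => ?_⟩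
  have hy : ∀ i, ∃ y, (f i).1 = s(x, y) := fun i => (f i).2.2
  choose y hy using hy
  have hxy : ∀ i, G.Adj x (y i) := by
    intro i
    have := (f i).2.1
    rwa [hy] at this
  have hyinj : Function.Injective y := by
    intro i j hij
    apply hf.injective
    apply Subtype.ext
    rw [hy, hy, hij]
  have hF0 := hM.cubeVertex_self x
  have ha : ∀ i, ∃ a, hM.cubeVertex x (y i) = {a} := by
    intro i
    obtain ⟨a, ha⟩ := hM.symmDiff_cubeVertex_of_adj (b := x) (hxy i)
    refine ⟨a, ?_⟩
    rwa [hF0, ← Finset.bot_eq_empty, bot_symmDiff] at ha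
  choose a ha using ha
  have hFinj := (hM.isIsometric_cubeVertex x).injective
  have hainj : Function.Injective a := by
    intro i j hij
    apply hyinj
    apply hFinj
    rw [ha, ha, hij]
  have hz : ∀ i j, (cycleGraph (2 * k + 1)).Adj i j →
      ∃ z, hM.cubeVertex x z = {a i, a j} := by
    intro i j hij
    obtain ⟨y', z, w', hC, e₁, e₂⟩ := hf.adj.2 hij
    rw [hy, Sym2.congr_right] at e₁ e₂
    subst e₁ e₂
    have key : ∀ i, G.Adj (y i) z → ∃ b, hM.cubeVertex x z = {a i, b} := by
      intro i hiz
      have hadj := (hM.isIsometric_cubeVertex x).adj.2 hiz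
      rw [ha] at hadj
      rcases hadj with h | h
      · obtain ⟨b, -, hb⟩ := Finset.covBy_iff_exists_insert.1 h
        exact ⟨b, by rw [← hb, Finset.pair_comm]⟩
      · exfalso
        refine hC.2.2.2.2.1 (hFinj ?_)
        rw [hF0]
        have := Finset.card_lt_card h.lt
        rw [Finset.card_singleton] at this
        exact (Finset.card_eq_zero.1 (by omega)).symm
    obtain ⟨b, hb⟩ := key i hC.2.1
    obtain ⟨b', hb'⟩ := key j hC.2.2.1.symm
    refine ⟨z, ?_⟩
    have hmem : a j ∈ ({a i, b} : Finset _) := by rw [← hb, hb']; simp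
    rw [Finset.mem_insert, Finset.mem_singleton] at hmem
    rw [hb, hmem.resolve_left fun h => hij.ne (hainj h).symm]
  refine hM.isIsometricSubgraph_of_cubeVertex hainj hK fun s hs => ?_
  obtain ⟨hcard, hclique⟩ := hP s hs
  obtain h0 | h1 | h2 : s.card = 0 ∨ s.card = 1 ∨ s.card = 2 := by omega
  · rw [Finset.card_eq_zero] at h0
    subst h0
    exact ⟨x, fun A => by simp [hF0]⟩
  · obtain ⟨i, rfl⟩ := Finset.card_eq_one.1 h1
    exact ⟨y i, fun A => by simp [ha, eq_comm]⟩
  · obtain ⟨i, j, hij, rfl⟩ := Finset.card_eq_two.1 h2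
    obtain ⟨z, hz⟩ := hz i j (hclique (by simp) (by simp) hij)
    exact ⟨z, fun A => by simp [hz, eq_comm]⟩

theorem vertexLink_isBipartite (hM : IsLocallyMedian G)
    (hQ : ¬ IsIsometricSubgraph cubeMinusVertex G)
    (hW : ∀ k, 2 ≤ k → ¬ IsIsometricSubgraph (cogwheel (2 * k + 1)) G) (x : V) :
    (vertexLink G x).IsBipartite := by
  by_contra h
  obtain ⟨k, hk, hiso⟩ := hM.exists_of_not_isBipartite_vertexLink h
  by_cases hk1 : k = 1
  · subst hk1
    refine hQ (hiso _ _ cubeMinusVertex_edist fun s hs => ⟨?_, fun i _ j _ hij => ?_⟩)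
    · have h1 := Finset.card_lt_card (Finset.ssubset_univ_iff.2 hs)
      simp at h1
      omega
    · change (cycleGraph 3).Adj i j
      rw [cycleGraph_three_eq_top]
      exact hij
  · refine hW k (by omega) (hiso _ _ simplexGraph_edist fun s hs => ⟨?_, hs⟩)
    -- A cycle of length at least 5 has no triangle.
    by_contra hcard
    obtain ⟨p, hp, q, hq, r, hr, hpq, hpr, hqr⟩ := Finset.two_lt_card.1 (not_le.1 hcard)
    have h1 := (cycleGraph_adj_iff_val (by omega) _ _).1 (hs hp hq hpq)
    have h2 := (cycleGraph_adj_iff_val (by omega) _ _).1 (hs hp hr hpr)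
    have h3 := (cycleGraph_adj_iff_val (by omega) _ _).1 (hs hq hr hqr)
    have := Fin.val_ne_of_ne hpq
    have := Fin.val_ne_of_ne hpr
    have := Fin.val_ne_of_ne hqr
    omega

end IsLocallyMedian

end OddLinks

/-! ### Medians and squares in products of two trees. -/

section TreeProducts

variable {V₁ V₂ : Type*} {T : SimpleGraph V₁} {T₁ : SimpleGraph V₁} {T₂ : SimpleGraph V₂}

theorem _root_.SimpleGraph.IsTree.eq_of_dist_eq_succ (hT : T.IsTree) {b x y₁ y₂ : V₁}
    (h₁ : T.Adj x y₁) (h₂ : T.Adj x y₂) (d₁ : T.dist b x = T.dist b y₁ + 1)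
    (d₂ : T.dist b x = T.dist b y₂ + 1) : y₁ = y₂ := by
  obtain ⟨p, hp⟩ := hT.connected.exists_walk_length_eq_dist b y₁
  obtain ⟨q, hq⟩ := hT.connected.exists_walk_length_eq_dist b y₂
  have hp' : (p.concat h₁.symm).IsPath :=
    Walk.isPath_of_length_eq_dist _ (by rw [Walk.length_concat, hp, d₁])
  have hq' : (q.concat h₂.symm).IsPath :=
    Walk.isPath_of_length_eq_dist _ (by rw [Walk.length_concat, hq, d₂])
  have := (hT.existsUnique_path b x).unique hp' hq'
  have h3 := congrArg Walk.penultimate this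
  simpa using h3

theorem _root_.SimpleGraph.IsTree.eq_of_common_neighbors (hT : T.IsTree) {x v a b : V₁}
    (hxv : x ≠ v) (xa : T.Adj x a) (xb : T.Adj x b) (va : T.Adj v a) (vb : T.Adj v b) : a = b := by
  have h1 : T.dist x a = 1 := dist_eq_one_iff_adj.2 xa
  have h2 : T.dist x b = 1 := dist_eq_one_iff_adj.2 xb
  have h3 := hT.dist_eq_dist_add_one_of_adj x va
  have h4 := hT.connected.pos_dist_of_ne hxv
  exact hT.eq_of_dist_eq_succ (b := x) va vb (by omega) (by omega)

theorem isLocallyMedian_of_isTree (hT : T.IsTree) : IsLocallyMedian T where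
  connected := hT.connected
  bip := fun z _ _ h => hT.dist_ne_of_adj z h
  quad := fun _ _ _ _ _ _ h₁ h₂ hne d₁ d₂ => absurd (hT.eq_of_dist_eq_succ h₁ h₂ d₁ d₂) hne
  thin := fun _ _ _ _ _ hxv hab _ _ xa xb _ va vb _ =>
    hab (hT.eq_of_common_neighbors hxv xa xb va vb)

theorem dist_boxProd (h₁ : T₁.Connected) (h₂ : T₂.Connected) (p q : V₁ × V₂) :
    (T₁ □ T₂).dist p q = T₁.dist p.1 q.1 + T₂.dist p.2 q.2 := by
  have := edist_boxProd (G := T₁) (H := T₂) p q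
  rw [← ((h₁.boxProd h₂) p q).coe_dist_eq_edist, ← (h₁ _ _).coe_dist_eq_edist,
    ← (h₂ _ _).coe_dist_eq_edist] at this
  exact_mod_cast this

theorem mem_interval_boxProd (h₁ : T₁.Connected) (h₂ : T₂.Connected) {p q m : V₁ × V₂} :
    m ∈ interval (T₁ □ T₂) p q ↔ m.1 ∈ interval T₁ p.1 q.1 ∧ m.2 ∈ interval T₂ p.2 q.2 := by
  have t₁ := h₁.dist_triangle (u := p.1) (v := m.1) (w := q.1)
  have t₂ := h₂.dist_triangle (u := p.2) (v := m.2) (w := q.2)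
  simp only [interval, Set.mem_ofPred_eq, dist_boxProd h₁ h₂]
  omega

theorem IsMedian.boxProd (h₁ : IsMedian T₁) (h₂ : IsMedian T₂) : IsMedian (T₁ □ T₂) := by
  refine ⟨h₁.1.boxProd h₂.1, fun x y z => ?_⟩
  obtain ⟨m₁, hm₁⟩ := h₁.2 x.1 y.1 z.1
  obtain ⟨m₂, hm₂⟩ := h₂.2 x.2 y.2 z.2
  refine ⟨(m₁, m₂), Set.ext fun m => ?_⟩
  have e₁ : m.1 ∈ medianSet T₁ x.1 y.1 z.1 ↔ m.1 = m₁ := by rw [hm₁, Set.mem_singleton_iff]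
  have e₂ : m.2 ∈ medianSet T₂ x.2 y.2 z.2 ↔ m.2 = m₂ := by rw [hm₂, Set.mem_singleton_iff]
  rw [Set.mem_singleton_iff, Prod.ext_iff, ← e₁, ← e₂]
  simp only [medianSet, Set.mem_inter_iff, mem_interval_boxProd h₁.1 h₂.1]
  tauto

theorem _root_.SimpleGraph.IsTree.dist_eq_succ_of_mem_interval (hT : T.IsTree) {x y m x' : V₁}
    (hm : m ∈ interval T x y) (hxm : x ≠ m) (hx' : T.Adj x x')
    (hd : T.dist x y = T.dist x' y + 1) : T.dist x m = T.dist x' m + 1 := by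
  have hm : T.dist x y = T.dist x m + T.dist m y := hm
  obtain ⟨w, hw, hwd⟩ := exists_adj_dist_eq_succ hT.connected hxm
  have t₁ := hT.connected.dist_triangle (u := w) (v := m) (w := y)
  have t₂ := dist_le_succ_of_adj hT.connected hw y
  rw [T.dist_comm (u := y), T.dist_comm (u := y)] at t₂
  have : w = x' := by
    refine hT.eq_of_dist_eq_succ (b := y) hw hx' ?_ ?_
    · rw [T.dist_comm (u := y), T.dist_comm (u := y)]
      omega
    · rw [T.dist_comm (u := y), T.dist_comm (u := y), hd]
  rw [← this, hwd]

variable {V : Type u} {G : SimpleGraph V}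

/-- The first step of a geodesic from `x` to `y` moves one coordinate towards that of `f y`. In a
tree this is also the way to `M`, unless the coordinate already agrees with `M`; `hc₁` and `hc₂`
exclude that, since `f y` would then agree there too. -/
theorem exists_adj_closer_to_median (hG : G.Connected) (h₁ : T₁.IsTree) (h₂ : T₂.IsTree)
    {f : V → V₁ × V₂} (hf : IsIsometric G (T₁ □ T₂) f) {M : V₁ × V₂} {x y : V}
    (hM : M ∈ interval (T₁ □ T₂) (f x) (f y)) (hx : f x ≠ M)
    (hc₁ : (f x).1 = M.1 → (f y).1 = M.1) (hc₂ : (f x).2 = M.2 → (f y).2 = M.2) :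
    ∃ x', G.Adj x x' ∧ (T₁ □ T₂).dist (f x) M = (T₁ □ T₂).dist (f x') M + 1 := by
  have hxy : x ≠ y := by
    rintro rfl
    have hM : (T₁ □ T₂).dist (f x) (f x) = _ + _ := hM
    rw [(T₁ □ T₂).dist_self] at hM
    exact hx ((h₁.connected.boxProd h₂.connected).dist_eq_zero_iff.1 (by omega))
  obtain ⟨x', hx', hd⟩ := exists_adj_dist_eq_succ hG hxy
  refine ⟨x', hx', ?_⟩
  obtain ⟨m₁, m₂⟩ := (mem_interval_boxProd h₁.connected h₂.connected).1 hM
  have hadj := hf.adj.2 hx'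
  rw [← hf.dist, ← hf.dist] at hd
  rw [dist_boxProd h₁.connected h₂.connected, dist_boxProd h₁.connected h₂.connected] at hd ⊢
  rw [boxProd_adj] at hadj
  rcases hadj with ⟨ha, he⟩ | ⟨ha, he⟩
  · rw [← he] at hd ⊢
    have hne : (f x).1 ≠ M.1 := by
      intro h
      rw [h, hc₁ h, T₁.dist_self] at hd
      omega
    have := h₁.dist_eq_succ_of_mem_interval m₁ hne ha (by omega)
    omega
  · rw [← he] at hd ⊢
    have hne : (f x).2 ≠ M.2 := by
      intro h
      rw [h, hc₂ h, T₂.dist_self] at hd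
      omega
    have := h₂.dist_eq_succ_of_mem_interval m₂ hne ha (by omega)
    omega

theorem mem_interval_of_closer {H : SimpleGraph V} (hH : H.Connected) {x x' y m : V}
    (hm : m ∈ interval H x y) (hx : H.Adj x x') (hd : H.dist x m = H.dist x' m + 1) :
    m ∈ interval H x' y := by
  have hm : H.dist x y = H.dist x m + H.dist m y := hm
  have := dist_le_succ_of_adj hH hx y
  rw [H.dist_comm (u := y), H.dist_comm (u := y)] at this
  exact mem_interval_of_le hH (by omega)

theorem exists_eq_median (hG : G.Connected) (h₁ : T₁.IsTree) (h₂ : T₂.IsTree)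
    {f : V → V₁ × V₂} (hf : IsIsometric G (T₁ □ T₂) f) {M : V₁ × V₂} (x y z : V)
    (hxy : M ∈ interval (T₁ □ T₂) (f x) (f y)) (hyz : M ∈ interval (T₁ □ T₂) (f y) (f z))
    (hzx : M ∈ interval (T₁ □ T₂) (f z) (f x)) : ∃ m, f m = M := by
  have hT := h₁.connected.boxProd h₂.connected
  induction hn : (T₁ □ T₂).dist (f x) M + (T₁ □ T₂).dist (f y) M + (T₁ □ T₂).dist (f z) M
    using Nat.strong_induction_on generalizing x y z with
  | _ n ih =>
  by_contra hno
  have hne : ∀ v, f v ≠ M := fun v hv => hno ⟨v, hv⟩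
  have hne' : ∀ v, ¬ ((f v).1 = M.1 ∧ (f v).2 = M.2) := fun v hv => hne v (Prod.ext hv.1 hv.2)
  -- a vertex cannot be moved towards the median along a geodesic to another one
  have stuck : ∀ p q r, M ∈ interval (T₁ □ T₂) (f p) (f q) → M ∈ interval (T₁ □ T₂) (f q) (f r) →
      M ∈ interval (T₁ □ T₂) (f r) (f p) →
      (T₁ □ T₂).dist (f p) M + (T₁ □ T₂).dist (f q) M + (T₁ □ T₂).dist (f r) M = n →
      ((f p).1 = M.1 → (f q).1 = M.1) → ((f p).2 = M.2 → (f q).2 = M.2) → False := by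
    intro p q r hpq hqr hrp hs hc₁ hc₂
    obtain ⟨p', hp', hd⟩ := exists_adj_closer_to_median hG h₁ h₂ hf hpq (hne p) hc₁ hc₂
    refine hno (ih _ ?_ p' q r (mem_interval_of_closer hT hpq (hf.adj.2 hp') hd) hqr ?_ rfl)
    · omega
    · rw [interval_comm] at hrp ⊢
      exact mem_interval_of_closer hT hrp (hf.adj.2 hp') hd
  have hyx := hxy
  have hzy := hyz
  have hxz := hzx
  rw [interval_comm] at hyx hzy hxz
  have s₁ := stuck x y z hxy hyz hzx hn
  have s₂ := stuck y x z hyx hxz hzy (by omega)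
  have s₃ := stuck y z x hyz hzx hxy (by omega)
  have s₄ := stuck z y x hzy hyx hxz (by omega)
  have s₅ := stuck z x y hzx hxy hyz (by omega)
  have s₆ := stuck x z y hxz hzy hyx (by omega)
  have nx := hne' x
  have ny := hne' y
  have nz := hne' z
  clear stuck hne hne' ih hno hyx hzy hxz hxy hyz hzx hn
  -- The sets of coordinates in which `f x`, `f y`, `f z` agree with `M` are now pairwise
  -- incomparable, but two coordinates allow no antichain of size three.
  by_cases x1 : (f x).1 = M.1 <;> by_cases x2 : (f x).2 = M.2 <;>
    by_cases y1 : (f y).1 = M.1 <;> by_cases y2 : (f y).2 = M.2 <;> simp_all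

/-- An isometric subgraph of the product of two trees is a median subgraph. -/
theorem IsIsometric.isMedianSubgraph (hG : G.Connected) (h₁ : T₁.IsTree) (h₂ : T₂.IsTree)
    {f : V → V₁ × V₂} (hf : IsIsometric G (T₁ □ T₂) f) : IsMedianSubgraph G (T₁ □ T₂) := by
  have hmed :=
    (isLocallyMedian_of_isTree h₁).isMedian.boxProd (isLocallyMedian_of_isTree h₂).isMedian
  refine ⟨f, hf, fun x y z => ?_⟩
  obtain ⟨M, hM⟩ := hmed.2 (f x) (f y) (f z)
  have hmem : M ∈ medianSet (T₁ □ T₂) (f x) (f y) (f z) := by rw [hM]; rfl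
  obtain ⟨m, rfl⟩ := exists_eq_median hG h₁ h₂ hf x y z hmem.1.1 hmem.1.2 hmem.2
  exact ⟨m, hM⟩

theorem IsMedianSubgraph.isMedian {W : Type*} {H : SimpleGraph W} (hG : G.Connected)
    (h : IsMedianSubgraph G H) : IsMedian G := by
  obtain ⟨f, hf, hmed⟩ := h
  refine ⟨hG, fun x y z => ?_⟩
  obtain ⟨m, hm⟩ := hmed x y z
  refine ⟨m, Set.ext fun v => ?_⟩
  rw [Set.mem_singleton_iff, ← hf.injective.eq_iff, ← Set.mem_singleton_iff (a := f v), ← hm]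
  simp only [medianSet, interval, Set.mem_inter_iff, Set.mem_ofPred_eq, hf.dist]

/-- As trees contain no 4-cycle, every square is a product of two edges, so its sides at a corner
move different coordinates. -/
theorem fst_eq_iff_not_of_square (h₁ : T₁.IsTree) (h₂ : T₂.IsTree) {p a b c : V₁ × V₂}
    (pa : (T₁ □ T₂).Adj p a) (pb : (T₁ □ T₂).Adj p b) (ca : (T₁ □ T₂).Adj c a)
    (cb : (T₁ □ T₂).Adj c b) (hab : a ≠ b) (hpc : p ≠ c) : ¬ (p.1 = a.1 ↔ p.1 = b.1) := by
  obtain ⟨p1, p2⟩ := p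
  obtain ⟨a1, a2⟩ := a
  obtain ⟨b1, b2⟩ := b
  obtain ⟨c1, c2⟩ := c
  rw [boxProd_adj] at pa pb ca cb
  simp only [ne_eq, Prod.mk.injEq] at *
  intro h
  rcases pa with ⟨pa, rfl⟩ | ⟨pa, rfl⟩ <;> rcases pb with ⟨pb, rfl⟩ | ⟨pb, rfl⟩
  · rcases ca with ⟨ca, rfl⟩ | ⟨ca, rfl⟩ <;> rcases cb with ⟨cb, h'⟩ | ⟨cb, rfl⟩
    · exact hab ⟨h₁.eq_of_common_neighbors (fun h => hpc ⟨h, rfl⟩) pa pb ca cb, rfl⟩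
    · exact cb.ne rfl
    · subst h'; exact ca.ne rfl
    · exact hab ⟨rfl, rfl⟩
  · exact pa.ne (h.2 rfl)
  · exact pb.ne (h.1 rfl)
  · rcases ca with ⟨ca, rfl⟩ | ⟨ca, rfl⟩ <;> rcases cb with ⟨cb, h'⟩ | ⟨cb, h'⟩
    · exact hab ⟨rfl, h'⟩
    · subst h'; exact ca.ne rfl
    · subst h'; exact cb.ne rfl
    · exact hab ⟨rfl, h₂.eq_of_common_neighbors (fun h => hpc ⟨rfl, h⟩) pa pb ca cb⟩

end TreeProducts

/-! ### Excluding cycles, cogwheels and `K_{2,3}`. -/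

section ForbiddenSubgraphs

theorem not_isBipartite_cycleGraph_odd {n : ℕ} (hn : 2 ≤ n) (hodd : Odd n) :
    ¬ (cycleGraph n).IsBipartite := by
  intro h
  have h2 := h.chromaticNumber_le
  rw [chromaticNumber_cycleGraph_of_odd n hn hodd] at h2
  exact absurd h2 (by norm_num)

/-- Here `min i (n - i)` measures how far `i` is from vertex 0 along the cycle, and an edge changes
it by at most one. -/
theorem val_min_le_dist_cycleGraph {n : ℕ} (hn : 2 ≤ n) {i j : Fin n}
    (p : (cycleGraph n).Walk i j) : min j.val (n - j.val) ≤ min i.val (n - i.val) + p.length := by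
  induction p with
  | nil => simp
  | cons h p ih =>
    have := (cycleGraph_adj_iff_val hn _ _).1 h
    rw [Walk.length_cons]
    omega

/-- The quadrangle condition fails at the antipode `c` of `o`: its two neighbours have only `c` in
common once the cycle is longer than 4. -/
theorem not_isMedian_cycleGraph {k : ℕ} (hk : 2 ≤ k) : ¬ IsMedian (cycleGraph (2 * k + 2)) := by
  intro h
  have hM := h.isLocallyMedian
  have hG := hM.connected
  have hn : 2 ≤ 2 * k + 2 := by omega
  let o : Fin (2 * k + 2) := ⟨0, by omega⟩
  let a : Fin (2 * k + 2) := ⟨k, by omega⟩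
  let c : Fin (2 * k + 2) := ⟨k + 1, by omega⟩
  let d : Fin (2 * k + 2) := ⟨k + 2, by omega⟩
  have ha : (cycleGraph (2 * k + 2)).dist o a ≤ k := by
    have := cycleGraph_edist_le_sub hn (i := o) (j := a) (Nat.zero_le _)
    rw [← (hG _ _).coe_dist_eq_edist, Nat.cast_le] at this
    exact this
  have hd : (cycleGraph (2 * k + 2)).dist o d ≤ k := by
    have := cycleGraph_edist_le_sub_sub hn (i := o) (j := d) (Nat.zero_le _)
    rw [← (hG _ _).coe_dist_eq_edist, Nat.cast_le] at this
    change _ ≤ 2 * k + 2 - (k + 2 - 0) at this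
    omega
  have hc : k + 1 ≤ (cycleGraph (2 * k + 2)).dist o c := by
    obtain ⟨p, hp⟩ := hG.exists_walk_length_eq_dist o c
    have := val_min_le_dist_cycleGraph hn p
    change min (k + 1) (2 * k + 2 - (k + 1)) ≤ min 0 (2 * k + 2 - 0) + p.length at this
    omega
  have hca : (cycleGraph (2 * k + 2)).Adj c a :=
    (cycleGraph_adj_iff_val hn _ _).2 (Or.inr (Or.inl rfl))
  have hcd : (cycleGraph (2 * k + 2)).Adj c d :=
    (cycleGraph_adj_iff_val hn _ _).2 (Or.inl rfl)
  have t₁ := dist_le_succ_of_adj hG hca o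
  have t₂ := dist_le_succ_of_adj hG hcd o
  obtain ⟨z, hz₁, hz₂, hz⟩ := hM.quad o _ c a d le_rfl hca hcd
    (by intro h; have : k = k + 2 := congrArg Fin.val h; omega) (by omega) (by omega)
  have e₁ := (cycleGraph_adj_iff_val hn _ _).1 hz₁
  have e₂ := (cycleGraph_adj_iff_val hn _ _).1 hz₂
  change k + 1 = z.val ∨ z.val + 1 = k ∨ (k = 0 ∧ z.val + 1 = 2 * k + 2) ∨
    (z.val = 0 ∧ k + 1 = 2 * k + 2) at e₁
  change k + 2 + 1 = z.val ∨ z.val + 1 = k + 2 ∨ (k + 2 = 0 ∧ z.val + 1 = 2 * k + 2) ∨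
    (z.val = 0 ∧ k + 2 + 1 = 2 * k + 2) at e₂
  have : z = c := Fin.ext (by change z.val = k + 1; omega)
  subst this
  omega

/-- Colour each spoke by the coordinate it moves. Consecutive spokes span a square and differ, which
would 2-colour an odd cycle. -/
theorem not_isIsometric_cogwheel {V₁ V₂ : Type*} {T₁ : SimpleGraph V₁} {T₂ : SimpleGraph V₂}
    (h₁ : T₁.IsTree) (h₂ : T₂.IsTree) {k : ℕ} (hk : 1 ≤ k) :
    ¬ IsIsometricSubgraph (cogwheel (2 * k + 1)) (T₁ □ T₂) := by
  classical
  rintro ⟨f, hf⟩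
  let F := cycleGraph (2 * k + 1)
  let hub : {s : Finset (Fin (2 * k + 1)) // F.IsClique s} := ⟨∅, by simp⟩
  let spoke : Fin (2 * k + 1) → {s : Finset (Fin (2 * k + 1)) // F.IsClique s} :=
    fun i => ⟨{i}, by simp⟩
  have hspoke : ∀ i, (cogwheel (2 * k + 1)).Adj hub (spoke i) := by
    intro i
    change (hypercube _).Adj ∅ {i}
    rw [hypercube_adj_iff, ← Finset.bot_eq_empty, bot_symmDiff, Finset.card_singleton]
  refine not_isBipartite_cycleGraph_odd (n := 2 * k + 1) (by omega) ⟨k, rfl⟩ ?_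
  have C : F.Coloring Bool := Coloring.mk (fun i => decide ((f hub).1 = (f (spoke i)).1)) (by
    intro i j hij heq
    let rim : {s : Finset (Fin (2 * k + 1)) // F.IsClique s} :=
      ⟨{i, j}, by
        intro a ha b hb hab
        simp only [Finset.coe_insert, Finset.coe_singleton, Set.mem_insert_iff,
          Set.mem_singleton_iff] at ha hb
        rcases ha with rfl | rfl <;> rcases hb with rfl | rfl
        · exact absurd rfl hab
        · exact hij
        · exact hij.symm
        · exact absurd rfl hab⟩
    have hi : (cogwheel (2 * k + 1)).Adj rim (spoke i) :=
      Or.inr (Finset.covBy_iff_exists_insert.2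
        ⟨j, fun h => hij.ne' (Finset.mem_singleton.1 h), Finset.pair_comm j i⟩)
    have hj : (cogwheel (2 * k + 1)).Adj rim (spoke j) :=
      Or.inr (Finset.covBy_iff_exists_insert.2 ⟨i, fun h => hij.ne (Finset.mem_singleton.1 h), rfl⟩)
    refine fst_eq_iff_not_of_square h₁ h₂ (hf.adj.2 (hspoke i)) (hf.adj.2 (hspoke j))
      (hf.adj.2 hi) (hf.adj.2 hj) ?_ ?_ (by simpa using heq)
    · intro h
      have := congrArg Subtype.val (hf.injective h)
      exact hij.ne (Finset.singleton_injective this)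
    · intro h
      have : ∅ = ({i, j} : Finset _) := congrArg Subtype.val (hf.injective h)
      exact (Finset.insert_ne_empty _ _) this.symm)
  have := C.colorable
  rwa [Fintype.card_bool] at this

theorem hypercube_isBipartite (X : Type u) : (hypercube X).IsBipartite := by
  classical
  have C : (hypercube X).Coloring Bool := Coloring.mk (fun s => decide (Even s.card)) (by
    have key : ∀ s t : Finset X, s ⋖ t → decide (Even s.card) ≠ decide (Even t.card) := by
      intro s t h
      obtain ⟨a, ha, rfl⟩ := Finset.covBy_iff_exists_insert.1 h
      rw [Finset.card_insert_of_notMem ha, ne_eq, decide_eq_decide, Nat.even_add_one]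
      tauto
    rintro s t (h | h)
    · exact key s t h
    · exact (key t s h).symm)
  have := C.colorable
  rwa [Fintype.card_bool] at this

theorem not_isIsometricSubgraph_hypercube_odd_cycle (X : Type u) {n : ℕ} (hn : 2 ≤ n)
    (hodd : Odd n) : ¬ IsIsometricSubgraph (cycleGraph n) (hypercube X) := by
  rintro ⟨f, hf⟩
  obtain ⟨c⟩ := hypercube_isBipartite X
  exact not_isBipartite_cycleGraph_odd hn hodd
    ⟨Coloring.mk (fun i => c (f i)) fun h => c.valid (hf.adj.2 h)⟩

/-- Common neighbours of two distinct vertices arise by switching an element of their symmetric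
difference, which has at most two elements. -/
theorem not_isIsometricSubgraph_hypercube_K23 (X : Type u) :
    ¬ IsIsometricSubgraph K23 (hypercube X) := by
  classical
  rintro ⟨f, hf⟩
  have hadj : ∀ i j, ∃ a, f (Sum.inl i) ∆ f (Sum.inr j) = {a} := fun i j =>
    Finset.card_eq_one.1 (hypercube_adj_iff.1 (hf.adj.2 (by simp [K23])))
  choose a ha using hadj
  have hsymm : ∀ j, f (Sum.inl 0) ∆ f (Sum.inl 1) = {a 0 j} ∆ {a 1 j} := by
    intro j
    rw [← ha, ← ha, symmDiff_comm (f (Sum.inl 1)), symmDiff_assoc, symmDiff_symmDiff_cancel_left]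
  have hmem : ∀ j, a 0 j ∈ f (Sum.inl 0) ∆ f (Sum.inl 1) := by
    intro j
    rw [hsymm j, Finset.mem_symmDiff, Finset.mem_singleton, Finset.mem_singleton]
    left
    refine ⟨rfl, fun h => ?_⟩
    have h0 := hsymm j
    rw [h, symmDiff_self, symmDiff_eq_bot] at h0
    exact absurd (hf.injective h0) (by simp)
  have hinj : Function.Injective (a 0) := by
    intro i j hij
    have : f (Sum.inl 0) ∆ f (Sum.inr i) = f (Sum.inl 0) ∆ f (Sum.inr j) := by rw [ha, ha, hij]
    exact Sum.inr_injective (hf.injective (symmDiff_right_injective _ this))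
  have hcard : (Finset.univ.image (a 0)).card = 3 := by
    rw [Finset.card_image_of_injective _ hinj]
    rfl
  have hle : Finset.univ.image (a 0) ⊆ {a 0 0, a 1 0} := by
    intro b hb
    obtain ⟨j, -, rfl⟩ := Finset.mem_image.1 hb
    have := hmem j
    rw [hsymm 0, Finset.mem_symmDiff] at this
    simp only [Finset.mem_insert, Finset.mem_singleton] at this ⊢
    tauto
  have := (Finset.card_le_card hle).trans Finset.card_le_two
  omega

/-- The hexagon consists of all vertices except the empty set, the antipode of the missing vertex.
-/
theorem isIsometricSubgraph_cycleGraph_six :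
    IsIsometricSubgraph (cycleGraph 6) cubeMinusVertex := by
  let B : Fin 6 → {s : Finset (Fin 3) // s ≠ Finset.univ} :=
    ![⟨{0}, by decide⟩, ⟨{0, 1}, by decide⟩, ⟨{1}, by decide⟩, ⟨{1, 2}, by decide⟩,
      ⟨{2}, by decide⟩, ⟨{0, 2}, by decide⟩]
  refine ⟨_, isIsometric_cycleGraph (L := 6) (f := fun k => B (Fin.ofNat 6 k)) (by omega) ?_ rfl ?_⟩
  · intro k hk
    change (hypercube (Fin 3)).Adj _ _
    rw [hypercube_adj_iff]
    interval_cases k <;> decide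
  · intro i j hij hj
    rw [cubeMinusVertex_edist, Nat.cast_le]
    interval_cases j <;> interval_cases i <;> decide

end ForbiddenSubgraphs

end DoubleTree

theorem theorem1 {V : Type u} (G : SimpleGraph V) (hG : G.Connected) :
    List.TFAE [
      DoubleTree.IsPartialDoubleTree G,
      DoubleTree.IsMedianSubgraphOfTwoTrees G,
      DoubleTree.IsMedian G ∧ (DoubleTree.incGraph G).IsBipartite,
      DoubleTree.IsMedian G ∧ (DoubleTree.linkGraph G).IsBipartite,
      DoubleTree.IsMedian G ∧ ∀ x : V, (DoubleTree.vertexLink G x).IsBipartite,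
      DoubleTree.IsMedian G ∧
        ¬ DoubleTree.IsIsometricSubgraph DoubleTree.cubeMinusVertex G ∧
        ∀ k : ℕ, 2 ≤ k →
          ¬ DoubleTree.IsIsometricSubgraph (DoubleTree.cogwheel (2 * k + 1)) G,
      (∃ X : Type u, DoubleTree.IsIsometricSubgraph G (DoubleTree.hypercube X)) ∧
        ∀ k : ℕ, 2 ≤ k →
          ¬ DoubleTree.IsIsometricSubgraph (SimpleGraph.cycleGraph (2 * k + 2)) G ∧
          ¬ DoubleTree.IsIsometricSubgraph (DoubleTree.cogwheel (2 * k + 1)) G,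
      ¬ DoubleTree.IsIsometricSubgraph (SimpleGraph.cycleGraph 3) G ∧
        ¬ DoubleTree.IsIsometricSubgraph DoubleTree.K23 G ∧
        ∀ k : ℕ, 2 ≤ k →
          ¬ DoubleTree.IsIsometricSubgraph (SimpleGraph.cycleGraph (k + 3)) G ∧
          ¬ DoubleTree.IsIsometricSubgraph (DoubleTree.cogwheel (2 * k + 1)) G] := by
  open DoubleTree in
  tfae_have 1 → 2 := by
    rintro ⟨V₁, V₂, T₁, T₂, h₁, h₂, f, hf⟩
    exact ⟨V₁, V₂, T₁, T₂, h₁, h₂, hf.isMedianSubgraph hG h₁ h₂⟩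
  tfae_have 2 → 7 := by
    rintro ⟨V₁, V₂, T₁, T₂, h₁, h₂, hmed⟩
    have hiso : IsIsometricSubgraph G (T₁ □ T₂) := ⟨hmed.choose, hmed.choose_spec.1⟩
    refine ⟨(hmed.isMedian hG).isLocallyMedian.isIsometricSubgraph_hypercube, fun k hk => ⟨?_, ?_⟩⟩
    · intro h
      obtain ⟨f, hf⟩ := h.trans hiso
      have hC : (cycleGraph (2 * k + 2)).Connected := cycleGraph_connected
      -- The cycle would itself be isometric in the product of trees, hence median.
      exact not_isMedian_cycleGraph hk ((hf.isMedianSubgraph hC h₁ h₂).isMedian hC)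
    · exact fun h => not_isIsometric_cogwheel h₁ h₂ (by omega) (h.trans hiso)
  tfae_have 7 → 8 := by
    rintro ⟨⟨X, hX⟩, h⟩
    refine ⟨fun h3 => not_isIsometricSubgraph_hypercube_odd_cycle X (by omega) (by decide)
      (h3.trans hX), fun hK => not_isIsometricSubgraph_hypercube_K23 X (hK.trans hX),
      fun k hk => ⟨fun hC => ?_, (h k hk).2⟩⟩
    rcases Nat.even_or_odd (k + 3) with he | ho
    · obtain ⟨j, hj⟩ := he
      refine (h (j - 1) (by omega)).1 ?_
      rwa [show 2 * (j - 1) + 2 = k + 3 by omega]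
    · exact not_isIsometricSubgraph_hypercube_odd_cycle X (by omega) ho (hC.trans hX)
  tfae_have 8 → 6 := by
    rintro ⟨h3, hK, h⟩
    exact ⟨(isLocallyMedian_of_no_isometric_cycle hG h3 hK fun k hk => (h k hk).1).isMedian,
      -- For `k = 3` the excluded cycle is the hexagon, which is isometric in `Q₃ - v`.
      fun hQ => (h 3 (by omega)).1 (isIsometricSubgraph_cycleGraph_six.trans hQ),
      fun k hk => (h k hk).2⟩
  tfae_have 6 → 5 := fun ⟨hM, hQ, hW⟩ => ⟨hM, hM.isLocallyMedian.vertexLink_isBipartite hQ hW⟩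
  tfae_have 5 → 4 := fun ⟨hM, hL⟩ => ⟨hM, hM.isLocallyMedian.linkGraph_isBipartite hL⟩
  tfae_have 4 → 3 := fun ⟨hM, hL⟩ => ⟨hM, hM.isLocallyMedian.incGraph_isBipartite hL⟩
  tfae_have 3 → 1 := fun ⟨hM, hI⟩ => hM.isPartialDoubleTree_of_incGraph hI
  tfae_finish
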